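/- Let $n\ge 1$ be an integer, $1\le p<\infty$ and $0<\alpha<n/p$. For nonnegative functions, $F\approx G$ means that each of $F,G$ is bounded by a constant multiple of the other. Let $\Phi$ be a function from $[0,\infty)$ onto $[0,\infty)$ which is equivalent to a strictly increasing function $\widetilde\Phi:[0,\infty)\to[0,\infty)$, i.e. $\Phi\approx\widetilde\Phi$, and assume: (i) $\Phi(0)=0$, and for every $c>0$, $\Phi(cs)\approx\Phi(s)$ as functions of $s$, with constants that may depend on $c$; (ii) there is $C<\infty$ such that for all $s>0$ $$\int_0^s\left[\frac{\Phi(u)}{u^{n-\alpha p}}\right]^{1/p}\frac{du}{u}\le C\left[\frac{\Phi(s)}{s^{n-\alpha p}}\right]^{1/p}.$$ For $g\in L^p(\mathbf R^n)$ let $R^\alpha g(x)=c(\alpha,n)\int_{\mathbf R^n}|x-y|^{\alpha-n}g(y)\,dy$ be its Riesz potential, where $c(\alpha,n)=\dfrac{\Gamma((n-\alpha)/2)}{2^\alpha\pi^{n/2}\Gamma(\alpha/2)}$. Let $h^\alpha_p=\{R^\alpha g: g\in L^p\}$ (functions being identified if they agree almost everywhere), with norm $\|R^\alpha g\|_{h^\alpha_p}=\|g\|_{L^p}$.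 For an open set $O\subset\mathbf R^n$ define the Riesz capacity $$\mathrm{cap}(O;h^\alpha_p)=\inf\{\|f\|_{h^\alpha_p}^p:\ f\in h^\alpha_p \text{ a Schwartz function},\ f\ge0,\ f\ge1\text{ on }O\}\in[0,\infty]$$ (with $\inf\emptyset=\infty$), and the tent $TO=\{(x,t): x\in O,\ 0<t<\mathrm{dist}(x,\partial O)\}$, where $\mathrm{dist}(x,\emptyset)=\infty$. Then for every positive Borel measure $\mu$ on the upper half-space $\mathbf R^n\times(0,\infty)$ the following are equivalent: (a) there is $C<\infty$ such that $\mu(TO)\le C\,\Phi\big(\mathrm{cap}(O;h^\alpha_p)^{1/(n-\alpha p)}\big)$ for all open sets $O\subset\mathbf R^n$ of finite capacity (where the capacity is infinite, the right-hand side is read as $\infty$ and nothing is required); (b) $\mu$ is a $\Phi$-Carleson measure: there is $C<\infty$ such that $\mu(TB)\le C\,\Phi(r)$ for all $r>0$ and all balls $B\subset\mathbf R^n$ of radius $r$. That is, $\mathrm{Cap}^{\Phi_\alpha}(h^\alpha_p)=C^\Phi$, where $\Phi_\alpha(s)=\Phi(s^{1/(n-\alpha p)})$, $\mathrm{Cap}^{\Phi_\alpha}(h^\alpha_p)$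 is the class of measures satisfying (a), and $C^\Phi$ is the class of measures satisfying (b). -/

import Mathlib

open MeasureTheory
open scoped NNReal ENNReal

noncomputable section

/-- The Euclidean space `ℝⁿ`. -/
abbrev Rn (n : ℕ) : Type := EuclideanSpace ℝ (Fin n)

/-- The upper half-space `ℝⁿ × (0, ∞)`, with its product (equivalently, Borel) σ-algebra. -/
abbrev UpperHalf (n : ℕ) : Type := Rn n × Set.Ioi (0 : ℝ)

/-- The tent `TO = {(x, t) : x ∈ O, 0 < t < dist (x, ∂O)}` over a set `O ⊆ ℝⁿ`.
The distance is `[0, ∞]`-valued, and the distance to the empty set is `∞`. -/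
def tent {n : ℕ} (O : Set (Rn n)) : Set (UpperHalf n) :=
  {z | z.1 ∈ O ∧ ENNReal.ofReal (z.2 : ℝ) < Metric.infEDist z.1 (frontier O)}

/-- The normalizing constant `c(α, n)` of the Riesz potential, for which the Riesz potential of
order `α` is the Fourier multiplier `|ξ|^(-α)` (for the transform `∫ f(x) e^{-i x·ξ} dx`). -/
def rieszConst (n : ℕ) (α : ℝ) : ℝ :=
  Real.Gamma ((n - α) / 2) / (2 ^ α * Real.pi ^ ((n : ℝ) / 2) * Real.Gamma (α / 2))

/-- The Riesz potential `R^α g (x) = c(α, n) ∫ |x - y|^(α - n) g(y) dy`.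
For `g ∈ L^p`, `1 ≤ p < n / α`, the integral converges absolutely for almost every `x`. -/
def rieszPotential {n : ℕ} (α : ℝ) (g : Rn n → ℝ) (x : Rn n) : ℝ :=
  rieszConst n α * ∫ y, ‖x - y‖ ^ (α - n) * g y

/-- The norm of `f` in the Riesz potential space `h^α_p = {f : f = R^α g, g ∈ L^p}`, namely
`‖g‖_{L^p}` if `f = R^α g` almost everywhere with `g ∈ L^p`;
it is `∞` if `f` is not in `h^α_p`. -/
def rieszNorm {n : ℕ} (α p : ℝ) (f : Rn n → ℝ) : ℝ≥0∞ :=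
  ⨅ (g : Rn n → ℝ) (_ : MemLp g (ENNReal.ofReal p) volume)
    (_ : f =ᵐ[volume] rieszPotential α g), eLpNorm g (ENNReal.ofReal p) volume

/-- The Riesz capacity
`cap(O; h^α_p) = inf {‖f‖_{h^α_p}^p : f Schwartz, f ≥ 0, f ≥ 1 on O}`, with `inf ∅ = ∞`. -/
def rieszCap {n : ℕ} (α p : ℝ) (O : Set (Rn n)) : ℝ≥0∞ :=
  ⨅ (f : SchwartzMap (Rn n) ℝ) (_ : ∀ x, 0 ≤ f x) (_ : ∀ x ∈ O, 1 ≤ f x), rieszNorm α p f ^ p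

/-- Extension of a function on `[0, ∞)` to `[0, ∞]` by the value `∞` at `∞`. -/
def extendTop (Ψ : ℝ≥0 → ℝ≥0) (s : ℝ≥0∞) : ℝ≥0∞ :=
  if s = ∞ then ∞ else (Ψ s.toNNReal : ℝ≥0∞)

/-- The class `Cap^Ψ(h^α_p)`: Borel measures `μ` on the upper half-space such that
`μ(TO) ≤ C Ψ(cap(O; h^α_p))` for all open sets `O`, with `C` independent of `O`. -/
def CapClass (n : ℕ) (α p : ℝ) (Ψ : ℝ≥0 → ℝ≥0) : Set (Measure (UpperHalf n)) :=
  {μ | ∃ C : ℝ≥0, 0 < C ∧ ∀ O : Set (Rn n), IsOpen O →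
    μ (tent O) ≤ C * extendTop Ψ (rieszCap α p O)}

/-- The class `C^Φ` of `Φ`-Carleson measures: Borel measures `μ` on the upper half-space such that
`μ(TB) ≤ C Φ(r)` for all balls `B` of radius `r`, with `C` independent of `B`. -/
def CarlesonClass (n : ℕ) (Φ : ℝ≥0 → ℝ≥0) : Set (Measure (UpperHalf n)) :=
  {μ | ∃ C : ℝ≥0, 0 < C ∧ ∀ (x : Rn n) (r : ℝ≥0), 0 < r →
    μ (tent (Metric.ball x r)) ≤ C * Φ r}

/-- `F ≈ G`: each function is bounded by a constant multiple of the other. -/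
def Comparable (F G : ℝ≥0 → ℝ≥0) : Prop :=
  ∃ C : ℝ≥0, 0 < C ∧ ∀ s, F s ≤ C * G s ∧ G s ≤ C * F s

/-- The doubling-type condition: `Φ(0) = 0`, and `Φ(c s) ≈ Φ(s)` for every `c > 0`, with constants
that may depend on `c` but not on `s`. -/
def DoublingCondition (Φ : ℝ≥0 → ℝ≥0) : Prop :=
  Φ 0 = 0 ∧ ∀ c : ℝ≥0, 0 < c → Comparable (fun s => Φ (c * s)) Φ

/-- The integral condition: for all `s > 0`, with `C` independent of `s`,
`∫₀ˢ (Φ(u) / u^(n - α p))^(1/p) du / u ≤ C (Φ(s) / s^(n - α p))^(1/p)`. -/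
def IntegralCondition (n : ℕ) (α p : ℝ) (Φ : ℝ≥0 → ℝ≥0) : Prop :=
  ∃ C : ℝ, 0 < C ∧ ∀ s : ℝ, 0 < s →
    ∫⁻ u in Set.Ioo 0 s,
        ENNReal.ofReal (((Φ u.toNNReal : ℝ) / u ^ (n - α * p)) ^ (1 / p) / u) ≤
      ENNReal.ofReal (C * ((Φ s.toNNReal : ℝ) / s ^ (n - α * p)) ^ (1 / p))

end

/-! ### Tents -/

/-! (a) ⇒ (b) only needs cap(B(x, r)) ≲ r^(n - αp). The Gaussian is a constant multiple of `R^α g`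
with `g` in every L^p, p ≥ 1 (`exists_rieszPotential_eq_gaussian`). Translating and dilating it
gives the capacity bound by scaling (`exists_rieszCap_ball_le`), and the doubling condition absorbs
the constant. Here `g` is the inverse Fourier transform of |ξ|^α e^(-π|ξ|²); the work is to show it
integrable although |ξ|^α need not be smooth at 0, and to compute its potential by writing the Riesz
kernel as a superposition of heat kernels.

(b) ⇒ (a) is a direct duality argument. Let ν be μ restricted to TO, of mass M = Φ(s), and let `R^α
g` agree a.e. with some f ≥ 1 on O. Averaging over B(x, t) ⊆ O for (x, t) ∈ TO gives 1 ≲ ∫ max(|x -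
y|, 2t)^(α-n) |g(y)| dy. Integrate this against ν and write the kernel as an integral over scales ρ
> max(|x - y|, 2t). At each scale, Hölder on the pairs with |x - y| < ρ, 2t < ρ yields N(ρ)^(1/p)
‖g‖_p (M ρ^n)^(1-1/p), where N(ρ) = min(M, C Φ(2ρ)) dominates ν(T B(y, 2ρ)). The integral condition
controls the scales below s, the bound N ≤ M those above, and M cancels, leaving s^(n/p - α) ≲ ‖g‖_p
(`exists_rpow_le_mul_eLpNorm`). Taking the infimum gives s ≲ cap(O)^(1/(n-αp)); applying Φ
concludes. The argument is uniform in p ≥ 1, including p = 1. -/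

lemma infEDist_frontier_subset_ball {X : Type*} [NormedAddCommGroup X] [NormedSpace ℝ X]
    {O : Set X} (hO : IsOpen O) {x : X} (hx : x ∈ O) {t : ℝ}
    (ht : ENNReal.ofReal t ≤ Metric.infEDist x (frontier O)) : Metric.ball x t ⊆ O := by
  rcases le_or_gt t 0 with h0 | h0
  · simp [Metric.ball_eq_empty.2 h0]
  have hdisj : Disjoint (frontier O) (Metric.ball x t) := by
    rw [Set.disjoint_left]
    intro w hw hwb
    have h1 : Metric.infEDist x (frontier O) ≤ edist x w := Metric.infEDist_le_edist_of_mem hw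
    rw [edist_dist, dist_comm] at h1
    have h2 := ht.trans h1
    rw [ENNReal.ofReal_le_ofReal_iff dist_nonneg] at h2
    exact absurd (Metric.mem_ball.1 hwb) (not_lt.2 h2)
  -- The ball misses the frontier, so its trace on `O` is clopen in a connected set and contains the
  -- centre.
  have hclopen := isClopen_preimage_val hO hdisj
  have hconn : IsPreconnected (Metric.ball x t) := (convex_ball x t).isPreconnected
  have : PreconnectedSpace (Metric.ball x t) := isPreconnected_iff_preconnectedSpace.1 hconn
  have huniv := hclopen.eq_univ ⟨⟨x, Metric.mem_ball_self h0⟩, hx⟩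
  intro w hw
  have : (⟨w, hw⟩ : Metric.ball x t) ∈ (Subtype.val ⁻¹' O : Set (Metric.ball x t)) := by
    rw [huniv]; trivial
  exact this

lemma ball_subset_of_mem_tent {n : ℕ} {O : Set (Rn n)} (hO : IsOpen O) {z : UpperHalf n}
    (hz : z ∈ tent O) : Metric.ball z.1 (z.2 : ℝ) ⊆ O :=
  infEDist_frontier_subset_ball hO hz.1 hz.2.le

/-- The frontiers are not nested, so balls mediate: a ball about x inside O lies in U, while
frontier points of the open set U lie outside U. -/
lemma tent_mono {n : ℕ} {O U : Set (Rn n)} (hO : IsOpen O) (hU : IsOpen U) (h : O ⊆ U) :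
    tent O ⊆ tent U := by
  rintro ⟨x, t⟩ ⟨hx, ht⟩
  refine ⟨h hx, ?_⟩
  obtain ⟨s, hs1, hs2⟩ := ENNReal.lt_iff_exists_nnreal_btwn.1 ht
  refine hs1.trans_le ?_
  have hball : Metric.ball x (s : ℝ) ⊆ O :=
    infEDist_frontier_subset_ball hO hx (by simpa using hs2.le)
  refine Metric.le_infEDist.2 fun w hw => ?_
  have hwU : w ∉ U := by
    rw [hU.frontier_eq] at hw
    exact hw.2
  have hwb : w ∉ Metric.ball x (s : ℝ) := fun hb => hwU (h (hball hb))
  rw [Metric.mem_ball, not_lt, dist_comm] at hwb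
  rw [edist_dist, ← ENNReal.ofReal_coe_nnreal]
  exact ENNReal.ofReal_le_ofReal hwb

lemma measurableSet_tent {n : ℕ} {O : Set (Rn n)} (hO : IsOpen O) : MeasurableSet (tent O) := by
  have h1 : Measurable fun z : UpperHalf n => ENNReal.ofReal (z.2 : ℝ) := by fun_prop
  have h2 : Measurable fun z : UpperHalf n => Metric.infEDist z.1 (frontier O) :=
    Metric.continuous_infEDist.measurable.comp measurable_fst
  exact (hO.measurableSet.preimage measurable_fst).inter (measurableSet_lt h1 h2)

/-- A point `(x, t)` with `|x - y| < ρ` and `2 t < ρ` lies in the tent over `B(y, 2ρ)`. -/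
lemma mem_tent_ball {n : ℕ} {z : UpperHalf n} {y : Rn n} {ρ : ℝ} (h1 : ‖z.1 - y‖ < ρ)
    (h2 : 2 * (z.2 : ℝ) < ρ) : z ∈ tent (Metric.ball y (2 * ρ)) := by
  have hz2 : (0 : ℝ) < z.2 := z.2.2
  refine ⟨by rw [Metric.mem_ball, dist_eq_norm]; linarith, ?_⟩
  have : ENNReal.ofReal (z.2 : ℝ) < ENNReal.ofReal ρ :=
    (ENNReal.ofReal_lt_ofReal_iff (by linarith)).2 (by linarith)
  refine this.trans_le (Metric.le_infEDist.2 fun w hw => ?_)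
  have hw' : dist w y = 2 * ρ := Metric.frontier_ball_subset_sphere hw
  rw [edist_dist]
  refine ENNReal.ofReal_le_ofReal ?_
  have := dist_triangle w z.1 y
  rw [dist_eq_norm z.1 y, dist_comm w z.1] at this
  linarith

/-! ### Averages of the Riesz kernel over balls -/

lemma lintegral_eq_mul_lintegral_smul {n : ℕ} (f : Rn n → ℝ≥0∞) {R : ℝ} (hR : 0 < R) :
    ∫⁻ x, f x = ENNReal.ofReal (R ^ n) * ∫⁻ x, f (R • x) := by
  have hemb : MeasurableEmbedding (fun x : Rn n => R • x) :=
    (Homeomorph.smulOfNeZero R hR.ne').measurableEmbedding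
  have h := hemb.lintegral_map (μ := volume) f
  have hmap : Measure.map (fun x : Rn n => R • x) volume
      = ENNReal.ofReal |(R ^ Module.finrank ℝ (Rn n))⁻¹| • volume :=
    Measure.map_addHaar_smul volume hR.ne'
  rw [hmap, lintegral_smul_measure] at h
  rw [← h, finrank_euclideanSpace_fin, abs_of_pos (by positivity), smul_eq_mul, ← mul_assoc,
    ← ENNReal.ofReal_mul (by positivity), mul_inv_cancel₀ (by positivity), ENNReal.ofReal_one,
    one_mul]

lemma lintegral_ball_norm_rpow {n : ℕ} (a : ℝ) {R : ℝ} (hR : 0 < R) :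
    ∫⁻ z in Metric.ball (0 : Rn n) R, ENNReal.ofReal (‖z‖ ^ a)
      = ENNReal.ofReal (R ^ (a + n)) *
        ∫⁻ z in Metric.ball (0 : Rn n) 1, ENNReal.ofReal (‖z‖ ^ a) := by
  rw [← lintegral_indicator Metric.isOpen_ball.measurableSet, lintegral_eq_mul_lintegral_smul _ hR,
    ← lintegral_indicator Metric.isOpen_ball.measurableSet, Real.rpow_add hR, Real.rpow_natCast,
    mul_comm (R ^ a), ENNReal.ofReal_mul (by positivity), mul_assoc]
  congr 1
  rw [← lintegral_const_mul' _ _ ENNReal.ofReal_ne_top]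
  congr 1 with z
  by_cases hz : z ∈ Metric.ball (0 : Rn n) 1
  · have hz' : R • z ∈ Metric.ball (0 : Rn n) R := by
      rw [mem_ball_zero_iff] at hz ⊢
      rw [norm_smul, Real.norm_of_nonneg hR.le]; nlinarith
    rw [Set.indicator_of_mem hz, Set.indicator_of_mem hz', norm_smul, Real.norm_of_nonneg hR.le,
      Real.mul_rpow hR.le (norm_nonneg _), ENNReal.ofReal_mul (by positivity)]
  · have hz' : R • z ∉ Metric.ball (0 : Rn n) R := by
      rw [mem_ball_zero_iff] at hz ⊢
      rw [norm_smul, Real.norm_of_nonneg hR.le]; nlinarith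
    rw [Set.indicator_of_notMem hz, Set.indicator_of_notMem hz', mul_zero]

lemma lintegral_ball_norm_rpow_ne_top {n : ℕ} (hn : 1 ≤ n) {α : ℝ} (hα : 0 < α) :
    ∫⁻ z in Metric.ball (0 : Rn n) 1, ENNReal.ofReal (‖z‖ ^ (α - n)) ≠ ⊤ := by
  have h : IntegrableOn (fun z : Rn n => ‖z‖ ^ (α - n)) (Metric.ball 0 1) := by
    refine integrableOn_ball_of_norm_le_rpow (C := 1) (α := n - α) (by simpa using hn)
      (by simpa using hα) (Filter.Eventually.of_forall fun z => ?_) ?_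
    · rw [Real.norm_of_nonneg (by positivity), one_mul, neg_sub]
    · exact (measurable_norm.pow_const _).aestronglyMeasurable
  exact h.lintegral_lt_top.ne

/-- If |x - y| ≥ 2t, then |z - y| ≥ |x - y|/2 on the ball and the kernel is essentially constant
there. Otherwise the ball lies in B(y, 3t), over which the kernel integrates to a multiple of t^α,
that is of t^n (2t)^(α-n). The constant has one summand for each case. -/
lemma exists_lintegral_ball_kernel_le {n : ℕ} (hn : 1 ≤ n) {α : ℝ} (hα : 0 < α) (hαn : α < n) :
    ∃ A : ℝ≥0∞, A ≠ ⊤ ∧ ∀ (x y : Rn n) (t : ℝ), 0 < t →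
      ∫⁻ z in Metric.ball x t, ENNReal.ofReal (‖z - y‖ ^ (α - n)) ≤
        A * volume (Metric.ball x t) * ENNReal.ofReal (max ‖x - y‖ (2 * t) ^ (α - n)) := by
  set I := ∫⁻ z in Metric.ball (0 : Rn n) 1, ENNReal.ofReal (‖z‖ ^ (α - n)) with hI
  have hItop : I ≠ ⊤ := lintegral_ball_norm_rpow_ne_top hn hα
  set V := volume (Metric.ball (0 : Rn n) 1)
  have hV0 : V ≠ 0 := (Metric.measure_ball_pos volume _ one_pos).ne'
  have hVtop : V ≠ ⊤ := measure_ball_lt_top.ne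
  refine ⟨ENNReal.ofReal (2 ^ (n - α)) + ENNReal.ofReal (3 ^ α * 2 ^ (n - α)) * I / V, ?_, ?_⟩
  · exact ENNReal.add_ne_top.2 ⟨ENNReal.ofReal_ne_top,
      ENNReal.div_ne_top (ENNReal.mul_ne_top ENNReal.ofReal_ne_top hItop) hV0⟩
  intro x y t ht
  rcases le_or_gt (2 * t) ‖x - y‖ with h | h
  · rw [max_eq_left h]
    have hpos : 0 < ‖x - y‖ := by linarith
    calc ∫⁻ z in Metric.ball x t, ENNReal.ofReal (‖z - y‖ ^ (α - n))
        ≤ ∫⁻ _ in Metric.ball x t, ENNReal.ofReal (2 ^ (n - α)) *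
            ENNReal.ofReal (‖x - y‖ ^ (α - n)) := by
          refine setLIntegral_mono (by fun_prop) fun z hz => ?_
          rw [← ENNReal.ofReal_mul (by positivity)]
          refine ENNReal.ofReal_le_ofReal ?_
          have h1 : ‖x - y‖ / 2 ≤ ‖z - y‖ := by
            have := norm_sub_le_norm_sub_add_norm_sub x z y
            rw [Metric.mem_ball, dist_comm, dist_eq_norm] at hz
            linarith
          calc ‖z - y‖ ^ (α - n) ≤ (‖x - y‖ / 2) ^ (α - n) :=
                Real.rpow_le_rpow_of_nonpos (by positivity) h1 (by linarith)
            _ = 2 ^ (n - α) * ‖x - y‖ ^ (α - n) := by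
                rw [Real.div_rpow hpos.le (by norm_num), div_eq_mul_inv,
                  ← Real.rpow_neg (by norm_num), neg_sub, mul_comm]
      _ = ENNReal.ofReal (2 ^ (n - α)) * volume (Metric.ball x t) *
            ENNReal.ofReal (‖x - y‖ ^ (α - n)) := by
          rw [setLIntegral_const]; ring
      _ ≤ _ := by gcongr; exact le_self_add
  · rw [max_eq_right h.le]
    have hsub : Metric.ball x t ⊆ Metric.ball y (3 * t) := by
      intro z hz
      rw [Metric.mem_ball] at hz ⊢
      have := dist_triangle z x y
      rw [dist_eq_norm x y] at this
      linarith
    have htrans : ∫⁻ z in Metric.ball y (3 * t), ENNReal.ofReal (‖z - y‖ ^ (α - n))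
        = ∫⁻ z in Metric.ball (0 : Rn n) (3 * t), ENNReal.ofReal (‖z‖ ^ (α - n)) := by
      rw [← lintegral_indicator Metric.isOpen_ball.measurableSet,
        ← lintegral_indicator Metric.isOpen_ball.measurableSet,
        ← lintegral_add_right_eq_self _ y]
      congr 1 with z
      simp [Set.indicator, dist_eq_norm]
    have hvol : volume (Metric.ball x t) = ENNReal.ofReal (t ^ n) * V := by
      have := Measure.addHaar_ball_of_pos (volume : Measure (Rn n)) x ht
      rwa [finrank_euclideanSpace_fin] at this
    calc ∫⁻ z in Metric.ball x t, ENNReal.ofReal (‖z - y‖ ^ (α - n))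
        ≤ ∫⁻ z in Metric.ball y (3 * t), ENNReal.ofReal (‖z - y‖ ^ (α - n)) :=
          lintegral_mono_set hsub
      _ = ENNReal.ofReal ((3 * t) ^ α) * I := by
          rw [htrans, lintegral_ball_norm_rpow _ (by positivity), sub_add_cancel]
      _ = ENNReal.ofReal (3 ^ α * 2 ^ (n - α)) * I / V * volume (Metric.ball x t) *
            ENNReal.ofReal ((2 * t) ^ (α - n)) := by
          have hr : (3 * t) ^ α = 3 ^ α * 2 ^ (n - α) * (t ^ n) * (2 * t) ^ (α - n) := by
            rw [Real.mul_rpow (by norm_num) ht.le, Real.mul_rpow (by norm_num) ht.le,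
              ← Real.rpow_natCast t n]
            have e1 : (2 : ℝ) ^ (n - α) * 2 ^ (α - n) = 1 := by
              rw [← Real.rpow_add (by norm_num)]; simp
            have e2 : t ^ (n : ℝ) * t ^ (α - n) = t ^ α := by
              rw [← Real.rpow_add ht]; congr 1; ring
            rw [← e2]
            linear_combination (-(3 : ℝ) ^ α * (t ^ (n : ℝ) * t ^ (α - n))) * e1
          rw [hvol, hr, ENNReal.ofReal_mul (by positivity), ENNReal.ofReal_mul (by positivity),
            div_eq_mul_inv]
          have hVV : V⁻¹ * V = 1 := ENNReal.inv_mul_cancel hV0 hVtop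
          calc _ = ENNReal.ofReal (3 ^ α * 2 ^ (n - α)) * I * 1 * ENNReal.ofReal (t ^ n) *
                ENNReal.ofReal ((2 * t) ^ (α - n)) := by ring
            _ = _ := by rw [← hVV]; ring
      _ ≤ _ := by gcongr; exact le_add_self

/-! ### The capacitary estimate for Carleson measures -/

lemma lintegral_Ioi_rpow_of_lt {a c : ℝ} (ha : a < -1) (hc : 0 < c) :
    ∫⁻ ρ in Set.Ioi c, ENNReal.ofReal (ρ ^ a) = ENNReal.ofReal (-c ^ (a + 1) / (a + 1)) := by
  rw [← integral_Ioi_rpow_of_lt ha hc, ofReal_integral_eq_lintegral_ofReal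
    (integrableOn_Ioi_rpow_of_lt ha hc)]
  filter_upwards [self_mem_ae_restrict measurableSet_Ioi] with ρ hρ
  exact Real.rpow_nonneg (hc.trans hρ).le _

/-- Layer-cake formula for a decreasing power; it decomposes the truncated kernel into indicators of
scales. -/
lemma ofReal_rpow_eq_lintegral {b m : ℝ} (hb : b < 0) (hm : 0 < m) :
    ENNReal.ofReal (m ^ b)
      = ENNReal.ofReal (-b) * ∫⁻ ρ in Set.Ioi m, ENNReal.ofReal (ρ ^ (b - 1)) := by
  rw [lintegral_Ioi_rpow_of_lt (by linarith) hm, ← ENNReal.ofReal_mul (by linarith)]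
  congr 1
  rw [sub_add_cancel]
  have := hb.ne
  field_simp

/-- No integrability is needed: a divergent Bochner integral has the default value 0. -/
lemma enorm_rieszPotential_le {n : ℕ} (α : ℝ) (g : Rn n → ℝ) (x : Rn n) :
    ‖rieszPotential α g x‖ₑ ≤
      ‖rieszConst n α‖ₑ * ∫⁻ y, ENNReal.ofReal (‖x - y‖ ^ (α - n)) * ‖g y‖ₑ := by
  rw [rieszPotential, enorm_mul]
  gcongr
  refine (enorm_integral_le_lintegral_enorm _).trans_eq ?_
  congr 1 with y
  rw [enorm_mul, Real.enorm_of_nonneg (by positivity)]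

/-- If `R^α g ≥ 1` on `O`, then a smoothed potential of `|g|` is bounded below on the tent. -/
lemma exists_one_le_lintegral_of_mem_tent {n : ℕ} (hn : 1 ≤ n) {α : ℝ} (hα : 0 < α)
    (hαn : α < n) :
    ∃ B : ℝ≥0∞, B ≠ ⊤ ∧ ∀ (O : Set (Rn n)) (_ : IsOpen O) (f g : Rn n → ℝ)
      (_ : AEStronglyMeasurable g volume) (_ : ∀ x ∈ O, 1 ≤ f x)
      (_ : f =ᵐ[volume] rieszPotential α g) (z : UpperHalf n) (_ : z ∈ tent O),
      1 ≤ B * ∫⁻ y, ENNReal.ofReal (max ‖z.1 - y‖ (2 * z.2) ^ (α - n)) * ‖g y‖ₑ := by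
  obtain ⟨A, hAtop, hA⟩ := exists_lintegral_ball_kernel_le hn hα hαn
  refine ⟨‖rieszConst n α‖ₑ * A, ENNReal.mul_ne_top enorm_ne_top hAtop, ?_⟩
  intro O hO f g hg hf hfg z hz
  have ht : (0 : ℝ) < z.2 := z.2.2
  set b := Metric.ball z.1 (z.2 : ℝ) with hb
  have hbO : b ⊆ O := ball_subset_of_mem_tent hO hz
  have hV0 : volume b ≠ 0 := (Metric.measure_ball_pos volume _ ht).ne'
  have hVtop : volume b ≠ ⊤ := measure_ball_lt_top.ne
  have hkm : Measurable fun w : Rn n × Rn n => ENNReal.ofReal (‖w.1 - w.2‖ ^ (α - n)) := by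
    fun_prop
  -- Integrate 1 ≤ |f| over B(x, t) ⊆ O and exchange the integrals. Averaging also makes an almost
  -- everywhere representation of f sufficient.
  have key : volume b ≤ volume b * (‖rieszConst n α‖ₑ * A *
      ∫⁻ y, ENNReal.ofReal (max ‖z.1 - y‖ (2 * z.2) ^ (α - n)) * ‖g y‖ₑ) := by
    calc volume b = ∫⁻ _ in b, 1 := by simp
      _ ≤ ∫⁻ w in b, ‖f w‖ₑ := by
          refine setLIntegral_mono' Metric.isOpen_ball.measurableSet fun w hw => ?_
          rw [Real.enorm_eq_ofReal_abs]
          exact ENNReal.one_le_ofReal.2 ((hf w (hbO hw)).trans (le_abs_self _))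
      _ = ∫⁻ w in b, ‖rieszPotential α g w‖ₑ := by
          refine lintegral_congr_ae (ae_restrict_of_ae ?_)
          filter_upwards [hfg] with w hw
          rw [hw]
      _ ≤ ∫⁻ w in b, ‖rieszConst n α‖ₑ *
            ∫⁻ y, ENNReal.ofReal (‖w - y‖ ^ (α - n)) * ‖g y‖ₑ :=
          lintegral_mono fun w => enorm_rieszPotential_le α g w
      _ = ‖rieszConst n α‖ₑ * ∫⁻ y, ∫⁻ w in b, ENNReal.ofReal (‖w - y‖ ^ (α - n)) * ‖g y‖ₑ := by
          rw [lintegral_const_mul' _ _ enorm_ne_top, lintegral_lintegral_swap]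
          exact hkm.aemeasurable.mul hg.enorm.comp_snd
      _ ≤ ‖rieszConst n α‖ₑ * ∫⁻ y, (A * volume b *
            ENNReal.ofReal (max ‖z.1 - y‖ (2 * z.2) ^ (α - n))) * ‖g y‖ₑ := by
          gcongr with y
          rw [lintegral_mul_const' _ _ enorm_ne_top]
          gcongr
          exact hA _ _ _ ht
      _ = _ := by
          simp_rw [mul_assoc]
          rw [lintegral_const_mul' _ _ hAtop, lintegral_const_mul' _ _ hVtop]
          ring
  by_contra! hlt
  have := ENNReal.mul_lt_mul_right hV0 hVtop hlt
  rw [mul_one] at this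
  exact absurd key (not_le.2 this)

/-- Pairs of a point `(x, t)` and a point `y` with `|x - y| < ρ` and `2 t < ρ`. -/
def nearPairs (n : ℕ) (ρ : ℝ) : Set (UpperHalf n × Rn n) :=
  {w | ‖w.1.1 - w.2‖ < ρ ∧ 2 * (w.1.2 : ℝ) < ρ}

lemma measurableSet_nearPairs_prod {n : ℕ} :
    MeasurableSet {v : (UpperHalf n × Rn n) × ℝ | v.1 ∈ nearPairs n v.2} := by
  have h1 : MeasurableSet {v : (UpperHalf n × Rn n) × ℝ | ‖v.1.1.1 - v.1.2‖ < v.2} :=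
    measurableSet_lt (by fun_prop) (by fun_prop)
  have h2 : MeasurableSet {v : (UpperHalf n × Rn n) × ℝ | 2 * (v.1.1.2 : ℝ) < v.2} :=
    measurableSet_lt (by fun_prop) (by fun_prop)
  exact h1.inter h2

lemma measurableSet_nearPairs {n : ℕ} (ρ : ℝ) : MeasurableSet (nearPairs n ρ) := by
  have h : Measurable fun w : UpperHalf n × Rn n => (w, ρ) := measurable_prodMk_right
  exact h measurableSet_nearPairs_prod

/-- Hölder against the constant 1 on the near pairs. For fixed y the admissible (x, t) lie in the
tent over B(y, 2ρ), which bounds the integral of |g|^p by N ‖g‖_p^p; for fixed (x, t) the admissible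
y lie in B(x, ρ), which bounds the total mass. -/
lemma lintegral_nearPairs_le {n : ℕ} {p : ℝ} (hp : 1 ≤ p) (ν : Measure (UpperHalf n))
    [IsFiniteMeasure ν] {g : Rn n → ℝ} (hg : AEStronglyMeasurable g volume) {ρ : ℝ} (hρ : 0 < ρ)
    {N : ℝ≥0∞} (hN : N ≠ ⊤) (hνN : ∀ y, ν (tent (Metric.ball y (2 * ρ))) ≤ N) :
    ∫⁻ w in nearPairs n ρ, ‖g w.2‖ₑ ∂(ν.prod volume) ≤
      N ^ (1 / p) * eLpNorm g (ENNReal.ofReal p) volume *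
        (ν Set.univ * (ENNReal.ofReal (ρ ^ n) * volume (Metric.ball (0 : Rn n) 1))) ^
          (1 - 1 / p) := by
  have hp0 : 0 < p := by linarith
  have hD := measurableSet_nearPairs (n := n) ρ
  set π := (ν.prod volume).restrict (nearPairs n ρ) with hπ
  have hgm : AEStronglyMeasurable (fun w : UpperHalf n × Rn n => g w.2) π :=
    hg.comp_snd.restrict
  have h1 := eLpNorm_le_eLpNorm_mul_rpow_measure_univ (p := 1) (q := ENNReal.ofReal p)
    (ENNReal.one_le_ofReal.2 hp) hgm
  rw [eLpNorm_one_eq_lintegral_enorm, ENNReal.toReal_ofReal hp0.le, ENNReal.toReal_one,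
    div_one] at h1
  refine h1.trans (mul_le_mul' ?_ (ENNReal.rpow_le_rpow ?_ ?_))
  · rw [eLpNorm_eq_lintegral_rpow_enorm_toReal (by simpa using hp0) ENNReal.ofReal_ne_top,
      eLpNorm_eq_lintegral_rpow_enorm_toReal (by simpa using hp0) ENNReal.ofReal_ne_top,
      ENNReal.toReal_ofReal hp0.le, ← ENNReal.mul_rpow_of_nonneg _ _ (by positivity)]
    refine ENNReal.rpow_le_rpow ?_ (by positivity)
    have hGm : AEMeasurable (fun w : UpperHalf n × Rn n => ‖g w.2‖ₑ ^ p) (ν.prod volume) :=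
      (hg.comp_snd.enorm).pow_const p
    rw [hπ, ← lintegral_indicator hD, lintegral_prod_symm _ (hGm.indicator hD),
      ← lintegral_const_mul' _ _ hN]
    refine lintegral_mono fun y => ?_
    calc ∫⁻ z, (nearPairs n ρ).indicator (fun w => ‖g w.2‖ₑ ^ p) (z, y) ∂ν
        = ∫⁻ z, ((fun z => (z, y)) ⁻¹' nearPairs n ρ).indicator (fun _ => ‖g y‖ₑ ^ p) z ∂ν := rfl
      _ = ‖g y‖ₑ ^ p * ν ((fun z => (z, y)) ⁻¹' nearPairs n ρ) := by
          rw [lintegral_indicator (hD.preimage measurable_prodMk_right), setLIntegral_const]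
      _ ≤ ‖g y‖ₑ ^ p * N := by
          gcongr
          exact (measure_mono fun z hz => mem_tent_ball hz.1 hz.2).trans (hνN y)
      _ = N * ‖g y‖ₑ ^ p := mul_comm _ _
  · rw [hπ, Measure.restrict_apply_univ, Measure.prod_apply hD, mul_comm (ν Set.univ),
      ← lintegral_const]
    refine lintegral_mono fun z => ?_
    have : ENNReal.ofReal (ρ ^ n) * volume (Metric.ball (0 : Rn n) 1)
        = volume (Metric.ball z.1 ρ) := by
      rw [Measure.addHaar_ball_of_pos (volume : Measure (Rn n)) _ hρ, finrank_euclideanSpace_fin]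
    rw [this]
    refine measure_mono fun y hy => ?_
    rw [Metric.mem_ball, dist_comm, dist_eq_norm]
    exact hy.1
  · have : 1 / p ≤ 1 := (div_le_one hp0).2 hp
    linarith

/-- Integrate the pointwise bound against ν, insert the layer-cake formula, and use Tonelli to bring
the scale ρ outside. -/
lemma measure_le_lintegral_nearPairs {n : ℕ} {α : ℝ} (hαn : α < n) {B : ℝ≥0∞} (hB : B ≠ ⊤)
    {g : Rn n → ℝ} (hg : AEStronglyMeasurable g volume) (ν : Measure (UpperHalf n))
    [IsFiniteMeasure ν]
    (h : ∀ᵐ z ∂ν, 1 ≤ B * ∫⁻ y, ENNReal.ofReal (max ‖z.1 - y‖ (2 * z.2) ^ (α - n)) * ‖g y‖ₑ) :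
    ν Set.univ ≤ B * ENNReal.ofReal (n - α) * ∫⁻ ρ in Set.Ioi (0 : ℝ),
      ENNReal.ofReal (ρ ^ (α - n - 1)) *
        ∫⁻ w in nearPairs n ρ, ‖g w.2‖ₑ ∂(ν.prod volume) := by
  have hker : ∀ z : UpperHalf n, ∀ y : Rn n,
      ENNReal.ofReal (max ‖z.1 - y‖ (2 * z.2) ^ (α - n)) * ‖g y‖ₑ
        = ENNReal.ofReal (n - α) * ∫⁻ ρ in Set.Ioi (0 : ℝ), ENNReal.ofReal (ρ ^ (α - n - 1)) *
          (nearPairs n ρ).indicator (fun w => ‖g w.2‖ₑ) (z, y) := by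
    intro z y
    have ht : (0 : ℝ) < z.2 := z.2.2
    have hm : 0 < max ‖z.1 - y‖ (2 * z.2) := lt_max_of_lt_right (by linarith)
    rw [ofReal_rpow_eq_lintegral (by linarith) hm, neg_sub, mul_assoc,
      ← lintegral_mul_const' _ _ enorm_ne_top]
    congr 1
    rw [← lintegral_indicator measurableSet_Ioi, ← lintegral_indicator measurableSet_Ioi]
    congr 1 with ρ
    have hmem : (z, y) ∈ nearPairs n ρ ↔ ρ ∈ Set.Ioi (max ‖z.1 - y‖ (2 * z.2)) := by
      simp [nearPairs]
    by_cases hρ : ρ ∈ Set.Ioi (max ‖z.1 - y‖ (2 * z.2))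
    · rw [Set.indicator_of_mem hρ, Set.indicator_of_mem (s := Set.Ioi 0) (hm.trans hρ),
        Set.indicator_of_mem (hmem.2 hρ)]
    · have h0 : (nearPairs n ρ).indicator (fun w => ‖g w.2‖ₑ) (z, y) = 0 :=
        Set.indicator_of_notMem (mt hmem.1 hρ) _
      rw [Set.indicator_of_notMem hρ]
      by_cases hρ0 : ρ ∈ Set.Ioi (0 : ℝ)
      · rw [Set.indicator_of_mem hρ0, h0, mul_zero]
      · rw [Set.indicator_of_notMem hρ0]
  have hJ : AEMeasurable (fun v : (UpperHalf n × Rn n) × ℝ =>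
      ENNReal.ofReal (v.2 ^ (α - n - 1)) *
        (nearPairs n v.2).indicator (fun w => ‖g w.2‖ₑ) v.1)
      ((ν.prod volume).prod (volume.restrict (Set.Ioi 0))) := by
    refine AEMeasurable.mul (by fun_prop) ?_
    have : (fun v : (UpperHalf n × Rn n) × ℝ => (nearPairs n v.2).indicator (fun w => ‖g w.2‖ₑ) v.1)
        = {v : (UpperHalf n × Rn n) × ℝ | v.1 ∈ nearPairs n v.2}.indicator
          (fun v => ‖g v.1.2‖ₑ) := rfl
    rw [this]
    exact (hg.enorm.comp_snd (μ := ν)).comp_fst.indicator measurableSet_nearPairs_prod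
  calc ν Set.univ = ∫⁻ _, 1 ∂ν := by simp
    _ ≤ ∫⁻ z, (B * ∫⁻ y, ENNReal.ofReal (max ‖z.1 - y‖ (2 * z.2) ^ (α - n)) * ‖g y‖ₑ) ∂ν :=
        lintegral_mono_ae h
    _ = B * ENNReal.ofReal (n - α) * ∫⁻ z, (∫⁻ y, ∫⁻ ρ in Set.Ioi (0 : ℝ),
          ENNReal.ofReal (ρ ^ (α - n - 1)) *
            (nearPairs n ρ).indicator (fun w => ‖g w.2‖ₑ) (z, y)) ∂ν := by
        simp_rw [hker]
        rw [lintegral_const_mul' _ _ hB, mul_assoc, ← lintegral_const_mul' _ _ ENNReal.ofReal_ne_top]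
        simp_rw [lintegral_const_mul' _ _ (ENNReal.ofReal_ne_top (r := n - α))]
    _ = B * ENNReal.ofReal (n - α) * ∫⁻ w, (∫⁻ ρ in Set.Ioi (0 : ℝ),
          ENNReal.ofReal (ρ ^ (α - n - 1)) *
            (nearPairs n ρ).indicator (fun w => ‖g w.2‖ₑ) w) ∂(ν.prod volume) := by
        rw [lintegral_prod _ hJ.lintegral_prod_right']
    _ = B * ENNReal.ofReal (n - α) * ∫⁻ ρ in Set.Ioi (0 : ℝ), ∫⁻ w,
          ENNReal.ofReal (ρ ^ (α - n - 1)) *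
            (nearPairs n ρ).indicator (fun w => ‖g w.2‖ₑ) w ∂(ν.prod volume) := by
        rw [lintegral_lintegral_swap hJ]
    _ = _ := by
        congr 2 with ρ
        rw [lintegral_const_mul' _ _ ENNReal.ofReal_ne_top, lintegral_indicator]
        exact measurableSet_nearPairs ρ

lemma coe_mul_ofReal_rpow_div {a : ℝ≥0} {ρ p d : ℝ} (hp : 0 < p) (hρ : 0 < ρ) :
    ENNReal.ofReal (((a : ℝ) / ρ ^ d) ^ (1 / p))
      = (a : ℝ≥0∞) ^ (1 / p) * ENNReal.ofReal (ρ ^ (-(d / p))) := by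
  rw [Real.div_rpow a.coe_nonneg (by positivity), ← Real.rpow_mul hρ.le, div_eq_mul_inv,
    ← Real.rpow_neg hρ.le, ENNReal.ofReal_mul (by positivity), mul_one_div,
    ← ENNReal.ofReal_rpow_of_nonneg a.coe_nonneg (by positivity)]
  simp

/-- Split at ρ = s. Below s, N ≤ C Φ(ρ) turns the integrand into that of the integral condition;
above s, N ≤ Φ(s) and the power is integrable at infinity because n/p - α > 0. -/
lemma exists_lintegral_rpow_mul_le {n : ℕ} {α p : ℝ} (hp : 1 ≤ p) (hαp : α < n / p)
    {Φ : ℝ≥0 → ℝ≥0} (hint : IntegralCondition n α p Φ) (C : ℝ≥0) :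
    ∃ K : ℝ≥0∞, K ≠ ⊤ ∧ ∀ (N : ℝ → ℝ≥0∞) (s : ℝ≥0) (_ : 0 < s) (_ : ∀ ρ, N ρ ≤ Φ s)
      (_ : ∀ ρ, 0 < ρ → N ρ ≤ C * Φ ρ.toNNReal),
      ∫⁻ ρ in Set.Ioi (0 : ℝ), ENNReal.ofReal (ρ ^ (-(n / p - α) - 1)) * N ρ ^ (1 / p)
        ≤ K * (Φ s : ℝ≥0∞) ^ (1 / p) * ENNReal.ofReal ((s : ℝ) ^ (-(n / p - α))) := by
  have hp0 : 0 < p := by linarith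
  have hp1 : 0 ≤ 1 / p := by positivity
  obtain ⟨C₂, hC₂, hC⟩ := hint
  set δ := n / p - α with hδ
  have hδ0 : 0 < δ := by linarith
  have hd : (n - α * p) / p = δ := by rw [hδ]; field_simp
  refine ⟨(C : ℝ≥0∞) ^ (1 / p) * ENNReal.ofReal C₂ + ENNReal.ofReal (1 / δ), ?_, ?_⟩
  · exact ENNReal.add_ne_top.2 ⟨ENNReal.mul_ne_top
      (ENNReal.rpow_ne_top_of_nonneg hp1 ENNReal.coe_ne_top) ENNReal.ofReal_ne_top,
      ENNReal.ofReal_ne_top⟩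
  intro N s hs hN1 hN2
  have hs' : (0 : ℝ) < s := hs
  have hsub : Set.Ioi (0 : ℝ) ⊆ Set.Ioo 0 (s : ℝ) ∪ Set.Ici (s : ℝ) := fun ρ hρ => by
    rcases lt_or_ge ρ s with h | h
    · exact Or.inl ⟨hρ, h⟩
    · exact Or.inr h
  refine (lintegral_mono_set hsub).trans ((lintegral_union_le _ _ _).trans ?_)
  rw [add_mul, add_mul]
  refine add_le_add ?_ ?_
  · calc ∫⁻ ρ in Set.Ioo 0 (s : ℝ), ENNReal.ofReal (ρ ^ (-δ - 1)) * N ρ ^ (1 / p)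
        ≤ ∫⁻ ρ in Set.Ioo 0 (s : ℝ), (C : ℝ≥0∞) ^ (1 / p) *
          ENNReal.ofReal (((Φ ρ.toNNReal : ℝ) / ρ ^ (n - α * p)) ^ (1 / p) / ρ) := by
          refine setLIntegral_mono' measurableSet_Ioo fun ρ hρ => ?_
          have h0 : 0 < ρ := hρ.1
          rw [ENNReal.ofReal_div_of_pos h0, coe_mul_ofReal_rpow_div hp0 h0, hd,
            Real.rpow_sub_one h0.ne', ENNReal.ofReal_div_of_pos h0]
          calc _ ≤ ENNReal.ofReal (ρ ^ (-δ)) / ENNReal.ofReal ρ *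
                (C * Φ ρ.toNNReal : ℝ≥0∞) ^ (1 / p) := by gcongr; exact hN2 ρ h0
            _ = _ := by
              rw [ENNReal.mul_rpow_of_nonneg _ _ hp1]
              simp only [div_eq_mul_inv]
              ring
      _ ≤ (C : ℝ≥0∞) ^ (1 / p) *
          ENNReal.ofReal (C₂ * ((Φ (s : ℝ).toNNReal : ℝ) / (s : ℝ) ^ (n - α * p)) ^ (1 / p)) := by
          rw [lintegral_const_mul' _ _ (ENNReal.rpow_ne_top_of_nonneg hp1 ENNReal.coe_ne_top)]
          gcongr
          exact hC s hs'
      _ = _ := by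
          rw [ENNReal.ofReal_mul hC₂.le, coe_mul_ofReal_rpow_div hp0 hs', hd, Real.toNNReal_coe]
          ring
  · calc ∫⁻ ρ in Set.Ici (s : ℝ), ENNReal.ofReal (ρ ^ (-δ - 1)) * N ρ ^ (1 / p)
        ≤ ∫⁻ ρ in Set.Ici (s : ℝ), ENNReal.ofReal (ρ ^ (-δ - 1)) * (Φ s : ℝ≥0∞) ^ (1 / p) := by
          gcongr with ρ; exact hN1 ρ
      _ = ENNReal.ofReal (-(s : ℝ) ^ (-δ - 1 + 1) / (-δ - 1 + 1)) * (Φ s : ℝ≥0∞) ^ (1 / p) := by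
          rw [lintegral_mul_const' _ _ (ENNReal.rpow_ne_top_of_nonneg hp1 ENNReal.coe_ne_top),
            setLIntegral_congr Ioi_ae_eq_Ici.symm, lintegral_Ioi_rpow_of_lt (by linarith) hs']
      _ = _ := by
          rw [sub_add_cancel, neg_div_neg_eq, div_eq_mul_inv, mul_comm _ (δ⁻¹), one_div δ,
            ENNReal.ofReal_mul (by positivity)]
          ring

/-- The measure of the tent over `O` controls from below the norm of `g` whenever `R^α g ≥ 1`
on `O`. -/
lemma exists_rpow_le_mul_eLpNorm {n : ℕ} (hn : 1 ≤ n) {α p : ℝ} (hp : 1 ≤ p) (hα : 0 < α)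
    (hαp : α < n / p) {Φ : ℝ≥0 → ℝ≥0} (hdoubling : DoublingCondition Φ)
    (hint : IntegralCondition n α p Φ) {μ : Measure (UpperHalf n)} (hμ : μ ∈ CarlesonClass n Φ) :
    ∃ K : ℝ≥0∞, K ≠ ⊤ ∧ ∀ (O : Set (Rn n)) (_ : IsOpen O) (f g : Rn n → ℝ)
      (_ : MemLp g (ENNReal.ofReal p) volume) (_ : ∀ x ∈ O, 1 ≤ f x)
      (_ : f =ᵐ[volume] rieszPotential α g) (s : ℝ≥0) (_ : Φ s ≠ 0) (_ : μ (tent O) = Φ s),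
      ENNReal.ofReal ((s : ℝ) ^ (n / p - α)) ≤ K * eLpNorm g (ENNReal.ofReal p) volume := by
  have hp0 : 0 < p := by linarith
  have hp1 : 0 ≤ 1 / p := by positivity
  have hp2 : 0 ≤ 1 - 1 / p := by
    have : 1 / p ≤ 1 := (div_le_one hp0).2 hp
    linarith
  have hαn : α < n := hαp.trans_le (div_le_self (by positivity) hp)
  obtain ⟨C₁, hC₁, hC⟩ := hμ
  obtain ⟨D, -, hD⟩ := hdoubling.2 2 two_pos
  obtain ⟨B, hB, hBt⟩ := exists_one_le_lintegral_of_mem_tent hn hα hαn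
  obtain ⟨K, hK, hKint⟩ := exists_lintegral_rpow_mul_le hp hαp hint (C₁ * D)
  set V := volume (Metric.ball (0 : Rn n) 1) with hV
  have hVtop : V ≠ ⊤ := measure_ball_lt_top.ne
  set B₀ := B * ENNReal.ofReal (n - α) with hB₀
  have hB₀top : B₀ ≠ ⊤ := ENNReal.mul_ne_top hB ENNReal.ofReal_ne_top
  refine ⟨B₀ * V ^ (1 - 1 / p) * K, ENNReal.mul_ne_top (ENNReal.mul_ne_top hB₀top
    (ENNReal.rpow_ne_top_of_nonneg hp2 hVtop)) hK, ?_⟩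
  intro O hO f g hgp hf hfg s hΦs hs
  have hs0 : 0 < s := by
    rw [pos_iff_ne_zero]
    rintro rfl
    exact hΦs hdoubling.1
  have hs0' : (0 : ℝ) < s := hs0
  set M : ℝ≥0∞ := (Φ s : ℝ≥0∞) with hM
  have hM0 : M ≠ 0 := by simpa [hM] using hΦs
  have hMtop : M ≠ ⊤ := ENNReal.coe_ne_top
  set G := eLpNorm g (ENNReal.ofReal p) volume with hG
  have hGtop : G ≠ ⊤ := hgp.2.ne
  have hg := hgp.1
  set ν := μ.restrict (tent O) with hν
  have hνuniv : ν Set.univ = M := by rw [hν, Measure.restrict_apply_univ, hs]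
  have : IsFiniteMeasure ν := ⟨by rw [hνuniv]; exact hMtop.lt_top⟩
  set N : ℝ → ℝ≥0∞ := fun ρ => min M (C₁ * Φ (2 * ρ.toNNReal)) with hN
  have hNtop : ∀ ρ, N ρ ≠ ⊤ := fun ρ => ((min_le_left _ _).trans_lt hMtop.lt_top).ne
  have hνN : ∀ ρ, 0 < ρ → ∀ y, ν (tent (Metric.ball y (2 * ρ))) ≤ N ρ := by
    intro ρ hρ y
    refine le_min ((measure_mono (Set.subset_univ _)).trans_eq hνuniv) ?_
    refine (Measure.restrict_apply_le _ _).trans ?_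
    have h := hC y (2 * ρ.toNNReal) (by positivity)
    rwa [NNReal.coe_mul, NNReal.coe_ofNat, Real.coe_toNNReal _ hρ.le] at h
  -- Doubling with factor 2 undoes the enlargement of the balls to radius 2ρ.
  have hN2 : ∀ ρ, 0 < ρ → N ρ ≤ (C₁ * D : ℝ≥0) * Φ ρ.toNNReal := by
    intro ρ _
    refine (min_le_right _ _).trans ?_
    rw [ENNReal.coe_mul, mul_assoc]
    gcongr
    exact_mod_cast (hD ρ.toNNReal).1
  have h1 := measure_le_lintegral_nearPairs hαn hB hg ν (by
    filter_upwards [self_mem_ae_restrict (measurableSet_tent hO)] with z hz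
    exact hBt O hO f g hg hf hfg z hz)
  rw [hνuniv] at h1
  have h2 : M ≤ B₀ * (G * (M * V) ^ (1 - 1 / p) *
      (K * M ^ (1 / p) * ENNReal.ofReal ((s : ℝ) ^ (-(n / p - α))))) := by
    refine h1.trans ?_
    gcongr
    refine le_trans ?_ (mul_le_mul_right (hKint N s hs0 (fun ρ => min_le_left _ _) hN2) _)
    have hGle : ∀ ρ ∈ Set.Ioi (0 : ℝ), ENNReal.ofReal (ρ ^ (α - n - 1)) *
        ∫⁻ w in nearPairs n ρ, ‖g w.2‖ₑ ∂(ν.prod volume) ≤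
        G * (M * V) ^ (1 - 1 / p) *
          (ENNReal.ofReal (ρ ^ (-(n / p - α) - 1)) * N ρ ^ (1 / p)) := by
      intro ρ hρ
      have hρ0 : 0 < ρ := hρ
      have h3 := lintegral_nearPairs_le hp ν hg hρ (hNtop ρ) (hνN ρ hρ)
      rw [hνuniv, ← hG, ← hV] at h3
      calc _ ≤ ENNReal.ofReal (ρ ^ (α - n - 1)) * _ := mul_le_mul_right h3 _
        _ = G * (M * V) ^ (1 - 1 / p) * (ENNReal.ofReal (ρ ^ (α - n - 1)) *
            ENNReal.ofReal (ρ ^ n) ^ (1 - 1 / p) * N ρ ^ (1 / p)) := by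
          rw [mul_left_comm M, ENNReal.mul_rpow_of_nonneg _ _ hp2]
          ring
        _ = _ := by
          congr 3
          rw [ENNReal.ofReal_rpow_of_nonneg (by positivity) hp2,
            ← ENNReal.ofReal_mul (by positivity), ← Real.rpow_natCast, ← Real.rpow_mul hρ0.le,
            ← Real.rpow_add hρ0]
          congr 2
          field_simp
          ring
    refine (setLIntegral_mono' measurableSet_Ioi hGle).trans ?_
    rw [lintegral_const_mul']
    exact ENNReal.mul_ne_top hGtop (ENNReal.rpow_ne_top_of_nonneg hp2
      (ENNReal.mul_ne_top hMtop hVtop))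
  -- The powers of M from Hölder and from the scale integral recombine, so the unknown mass cancels
  -- and only s remains.
  have hMM : M ^ (1 - 1 / p) * M ^ (1 / p) = M := by
    rw [← ENNReal.rpow_add _ _ hM0 hMtop, sub_add_cancel, ENNReal.rpow_one]
  have h4 : M * 1 ≤ M * (B₀ * V ^ (1 - 1 / p) * K * G *
      ENNReal.ofReal ((s : ℝ) ^ (-(n / p - α)))) := by
    rw [mul_one]
    refine h2.trans_eq ?_
    conv_rhs => rw [← hMM]
    rw [ENNReal.mul_rpow_of_nonneg _ _ hp2]
    ring
  have h5 := (ENNReal.mul_le_mul_iff_right hM0 hMtop).1 h4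
  calc ENNReal.ofReal ((s : ℝ) ^ (n / p - α))
      = 1 * ENNReal.ofReal ((s : ℝ) ^ (n / p - α)) := (one_mul _).symm
    _ ≤ (B₀ * V ^ (1 - 1 / p) * K * G * ENNReal.ofReal ((s : ℝ) ^ (-(n / p - α)))) *
        ENNReal.ofReal ((s : ℝ) ^ (n / p - α)) := by gcongr
    _ = B₀ * V ^ (1 - 1 / p) * K * G := by
        rw [mul_assoc _ (ENNReal.ofReal _), ← ENNReal.ofReal_mul (by positivity),
          ← Real.rpow_add hs0', neg_add_cancel, Real.rpow_zero, ENNReal.ofReal_one, mul_one]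

/-! ### From the norm estimate to the capacity estimate -/

/-- Finite capacity forces boundedness. -/
lemma isBounded_of_rieszCap_ne_top {n : ℕ} {α p : ℝ} {O : Set (Rn n)}
    (h : rieszCap α p O ≠ ⊤) : Bornology.IsBounded O := by
  obtain ⟨f, hf⟩ : ∃ f : SchwartzMap (Rn n) ℝ, ∀ x ∈ O, 1 ≤ f x := by
    by_contra! hcon
    refine h ?_
    simp only [rieszCap, iInf_eq_top]
    intro f _ h2
    obtain ⟨x, hx, hlt⟩ := hcon f
    exact absurd (h2 x hx) (not_le.2 hlt)
  have hev : ∀ᶠ x in Filter.cocompact (Rn n), f x < 1 :=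
    f.tendsto_cocompact.eventually (gt_mem_nhds one_pos)
  rw [Filter.eventually_iff, Filter.mem_cocompact] at hev
  obtain ⟨k, hk, hsub⟩ := hev
  refine hk.isBounded.subset fun x hx => ?_
  by_contra hxk
  exact absurd (hf x hx) (not_le.2 (hsub hxk))

lemma le_of_rpow_le_mul_rpow {s K c : ℝ≥0} {a b : ℝ} (ha : 0 < a) (h : s ^ a ≤ K * c ^ b) :
    s ≤ K ^ (1 / a) * c ^ (b / a) := by
  have := NNReal.rpow_le_rpow h (by positivity : 0 ≤ 1 / a)
  rwa [← NNReal.rpow_mul, mul_one_div_cancel ha.ne', NNReal.rpow_one, NNReal.mul_rpow,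
    ← NNReal.rpow_mul, mul_one_div] at this

/-- Each competitor gives (X/K)^p ≤ ‖f‖^p, and this passes to the infimum. Finiteness of the
capacity covers K = 0 when multiplying back. -/
lemma rpow_le_mul_rieszCap {n : ℕ} {α p : ℝ} (hp : 0 < p) {O : Set (Rn n)} {X K : ℝ≥0∞}
    (hK : K ≠ ⊤) (hcap : rieszCap α p O ≠ ⊤)
    (h : ∀ f g : Rn n → ℝ, MemLp g (ENNReal.ofReal p) volume → (∀ x ∈ O, 1 ≤ f x) →
      f =ᵐ[volume] rieszPotential α g → X ≤ K * eLpNorm g (ENNReal.ofReal p) volume) :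
    X ≤ K * rieszCap α p O ^ (1 / p) := by
  have h1 : (X / K) ^ p ≤ rieszCap α p O := by
    refine le_iInf fun f => le_iInf fun _ => le_iInf fun hf => ENNReal.rpow_le_rpow ?_ hp.le
    refine le_iInf fun g => le_iInf fun hg => le_iInf fun hfg => ENNReal.div_le_of_le_mul ?_
    rw [mul_comm]
    exact h f g hg hf hfg
  have h2 := ENNReal.rpow_le_rpow h1 (by positivity : 0 ≤ 1 / p)
  rw [← ENNReal.rpow_mul, mul_one_div_cancel hp.ne', ENNReal.rpow_one] at h2
  rwa [ENNReal.div_le_iff_le_mul (Or.inr (ENNReal.rpow_ne_top_of_nonneg (by positivity) hcap))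
    (Or.inl hK), mul_comm] at h2

/-- Φ itself need not be monotone, so the comparison passes through the increasing equivalent and
back, at the cost of C². -/
lemma exists_le_mul_of_doubling {Φ : ℝ≥0 → ℝ≥0}
    (hmono : ∃ Φ' : ℝ≥0 → ℝ≥0, StrictMono Φ' ∧ Comparable Φ Φ')
    (hdoubling : DoublingCondition Φ) {K : ℝ≥0} (hK : 0 < K) :
    ∃ C : ℝ≥0, 0 < C ∧ ∀ s u : ℝ≥0, s ≤ K * u → Φ s ≤ C * Φ u := by
  obtain ⟨Φ', hΦ', C, hC, hcomp⟩ := hmono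
  obtain ⟨D, hD, hdoub⟩ := hdoubling.2 K hK
  refine ⟨C * C * D, by positivity, fun s u hsu => ?_⟩
  calc Φ s ≤ C * Φ' s := (hcomp s).1
    _ ≤ C * Φ' (K * u) := by gcongr; exact hΦ'.monotone hsu
    _ ≤ C * (C * Φ (K * u)) := by gcongr; exact (hcomp _).2
    _ ≤ C * (C * (D * Φ u)) := by gcongr; exact (hdoub u).1
    _ = C * C * D * Φ u := by ring

theorem carlesonClass_subset_capClass {n : ℕ} (hn : 1 ≤ n) {α p : ℝ} (hp : 1 ≤ p) (hα : 0 < α)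
    (hαp : α < n / p) {Φ : ℝ≥0 → ℝ≥0} (hsurj : Function.Surjective Φ)
    (hmono : ∃ Φ' : ℝ≥0 → ℝ≥0, StrictMono Φ' ∧ Comparable Φ Φ')
    (hdoubling : DoublingCondition Φ) (hint : IntegralCondition n α p Φ) :
    CarlesonClass n Φ ⊆ CapClass n α p (fun s => Φ (s ^ (1 / (n - α * p)))) := by
  intro μ hμ
  have hp0 : 0 < p := by linarith
  have hδ : 0 < n / p - α := by linarith
  obtain ⟨K, hK, hKle⟩ := exists_rpow_le_mul_eLpNorm hn hp hα hαp hdoubling hint hμ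
  lift K to ℝ≥0 using hK
  -- The summand 1 only ensures positivity, since K may vanish.
  obtain ⟨C, hC, hCle⟩ := exists_le_mul_of_doubling hmono hdoubling
    (K := K ^ (1 / (n / p - α)) + 1) (by positivity)
  refine ⟨C, hC, fun O hO => ?_⟩
  by_cases hcap : rieszCap α p O = ⊤
  · rw [hcap, extendTop, if_pos rfl, ENNReal.mul_top (by simpa using hC.ne')]
    exact le_top
  rw [extendTop, if_neg hcap]
  -- O is bounded, so its tent lies in the tent of a ball. Finiteness is what lets surjectivity of Φ
  -- produce s with Φ(s) = μ(TO).
  have hfin : μ (tent O) ≠ ⊤ := by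
    obtain ⟨R, hR0, hR⟩ := (isBounded_of_rieszCap_ne_top hcap).subset_ball_lt 0 0
    obtain ⟨C₁, -, hC₁⟩ := hμ
    have h := (measure_mono (μ := μ) (tent_mono hO Metric.isOpen_ball hR)).trans
      (by simpa [hR0.le] using hC₁ 0 R.toNNReal (by simpa using hR0))
    exact (h.trans_lt (ENNReal.mul_lt_top ENNReal.coe_lt_top ENNReal.coe_lt_top)).ne
  obtain ⟨s, hs⟩ := hsurj (μ (tent O)).toNNReal
  have hs' : μ (tent O) = Φ s := by rw [hs, ENNReal.coe_toNNReal hfin]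
  rw [hs', ← ENNReal.coe_mul, ENNReal.coe_le_coe]
  by_cases hΦs : Φ s = 0
  · rw [hΦs]; positivity
  have hX := rpow_le_mul_rieszCap (α := α) hp0 ENNReal.coe_ne_top hcap
    fun f g hg hf hfg => hKle O hO f g hg hf hfg s hΦs hs'
  rw [← ENNReal.coe_toNNReal hcap, ← ENNReal.ofReal_rpow_of_nonneg s.coe_nonneg hδ.le,
    ENNReal.ofReal_coe_nnreal, ← ENNReal.coe_rpow_of_nonneg _ hδ.le,
    ← ENNReal.coe_rpow_of_nonneg _ (by positivity), ← ENNReal.coe_mul,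
    ENNReal.coe_le_coe] at hX
  have h1 := le_of_rpow_le_mul_rpow hδ hX
  have he : 1 / p / (n / p - α) = 1 / (n - α * p) := by
    have : n / p - α = (n - α * p) / p := by field_simp
    rw [this]
    field_simp
  rw [he] at h1
  refine hCle s _ (h1.trans ?_)
  gcongr
  exact le_self_add

/-! ### Gaussians and their moments as Schwartz functions -/

lemma hasTemperateGrowth_neg_pi_mul_norm_sq (n : ℕ) :
    (fun x : Rn n => -Real.pi * ‖x‖ ^ 2).HasTemperateGrowth := by
  fun_prop

/-- (1 + t)^M ≤ M! e^(1+t), and t - πt² ≤ 1. -/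
lemma one_add_pow_mul_exp_le (M : ℕ) {t : ℝ} (ht : 0 ≤ t) :
    (1 + t) ^ M * Real.exp (-Real.pi * t ^ 2) ≤ M.factorial * Real.exp 2 := by
  have h1 := Real.pow_div_factorial_le_exp (x := 1 + t) (by linarith) M
  rw [div_le_iff₀ (by positivity)] at h1
  calc (1 + t) ^ M * Real.exp (-Real.pi * t ^ 2)
      ≤ Real.exp (1 + t) * M.factorial * Real.exp (-Real.pi * t ^ 2) := by gcongr
    _ = M.factorial * Real.exp (1 + t + -Real.pi * t ^ 2) := by rw [Real.exp_add (1 + t)]; ring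
    _ ≤ M.factorial * Real.exp 2 := by
        gcongr
        nlinarith [Real.pi_gt_three, sq_nonneg (t - 1), sq_nonneg t]

/-- The Gaussian `exp (-π ‖x‖²)` as a Schwartz function. -/
noncomputable def gaussianSchwartz (n : ℕ) : SchwartzMap (Rn n) ℝ where
  toFun x := Real.exp (-Real.pi * ‖x‖ ^ 2)
  smooth' := Real.contDiff_exp.comp (hasTemperateGrowth_neg_pi_mul_norm_sq n).1
  decay' k N := by
    obtain ⟨l, C, hC, hbound⟩ :=
      (hasTemperateGrowth_neg_pi_mul_norm_sq n).norm_iteratedFDeriv_le_uniform N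
    refine ⟨N.factorial * (C + 1) ^ N * ((k + l * N).factorial * Real.exp 2), fun x => ?_⟩
    have h0 : (1 : ℝ) ≤ 1 + ‖x‖ := by linarith [norm_nonneg x]
    have hD1 : 1 ≤ (C + 1) * (1 + ‖x‖) ^ l :=
      one_le_mul_of_one_le_of_one_le (by linarith) (one_le_pow₀ h0)
    -- Faà di Bruno bound: every derivative of exp is exp, and the i-th derivative of the quadratic
    -- is at most D^i with D polynomial in the norm.
    have h := norm_iteratedFDeriv_comp_le (𝕜 := ℝ) (g := Real.exp) (n := N) (N := (⊤ : ℕ∞))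
      (f := fun x : Rn n => -Real.pi * ‖x‖ ^ 2) Real.contDiff_exp
      (hasTemperateGrowth_neg_pi_mul_norm_sq n).1 (mod_cast le_top) x
      (C := Real.exp (-Real.pi * ‖x‖ ^ 2)) (D := (C + 1) * (1 + ‖x‖) ^ l)
      (fun i _ => by
        rw [norm_iteratedFDeriv_eq_norm_iteratedDeriv, iteratedDeriv_eq_iterate,
          Real.iter_deriv_exp, Real.norm_of_nonneg (Real.exp_pos _).le])
      (fun i hi hiN => by
        refine (hbound i hiN x).trans (le_trans ?_ (le_self_pow₀ hD1 (by omega)))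
        gcongr
        linarith)
    calc ‖x‖ ^ k * ‖iteratedFDeriv ℝ N (fun x : Rn n => Real.exp (-Real.pi * ‖x‖ ^ 2)) x‖
        ≤ (1 + ‖x‖) ^ k * (N.factorial * Real.exp (-Real.pi * ‖x‖ ^ 2) *
          ((C + 1) * (1 + ‖x‖) ^ l) ^ N) := by
          gcongr
          · linarith
          · exact h
      _ = N.factorial * (C + 1) ^ N *
          ((1 + ‖x‖) ^ (k + l * N) * Real.exp (-Real.pi * ‖x‖ ^ 2)) := by
          rw [mul_pow, ← pow_mul, pow_add]; ring
      _ ≤ _ := by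
          exact mul_le_mul_of_nonneg_left (one_add_pow_mul_exp_le _ (norm_nonneg x))
            (by positivity)

lemma gaussianSchwartz_apply (n : ℕ) (x : Rn n) :
    gaussianSchwartz n x = Real.exp (-Real.pi * ‖x‖ ^ 2) := rfl

/-- The function `‖ξ‖^(2k) exp (-π ‖ξ‖²)` as a complex-valued Schwartz function. -/
noncomputable def gaussianMoment (n k : ℕ) : SchwartzMap (Rn n) ℂ :=
  SchwartzMap.postcompCLM (𝕜 := ℝ) Complex.ofRealCLM
    (SchwartzMap.smulLeftCLM ℝ (fun x : Rn n => (‖x‖ ^ 2) ^ k) (gaussianSchwartz n))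

lemma gaussianMoment_apply (n k : ℕ) (x : Rn n) :
    gaussianMoment n k x = (((‖x‖ ^ 2) ^ k * Real.exp (-Real.pi * ‖x‖ ^ 2) : ℝ) : ℂ) := by
  have h : Function.HasTemperateGrowth (fun x : Rn n => (‖x‖ ^ 2) ^ k) :=
    (Function.hasTemperateGrowth_norm_sq _).pow k
  rw [gaussianMoment, SchwartzMap.postcompCLM_apply, SchwartzMap.smulLeftCLM_apply_apply h]
  simp [gaussianSchwartz_apply]

/-! ### Integrals of Gamma type -/

lemma integrableOn_rpow_mul_exp_neg {a r : ℝ} (ha : 0 < a) (hr : 0 < r) :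
    IntegrableOn (fun t : ℝ => t ^ (a - 1) * Real.exp (-(r * t))) (Set.Ioi 0) := by
  have := integrableOn_rpow_mul_exp_neg_mul_rpow (s := a - 1) (p := 1) (by linarith) one_pos hr
  simpa using this

lemma integrableOn_rpow_mul_exp_neg_div {a r : ℝ} (ha : 0 < a) (hr : 0 < r) :
    IntegrableOn (fun t : ℝ => t ^ (-a - 1) * Real.exp (-(r / t))) (Set.Ioi 0) := by
  -- Substitution t ↦ 1/t, written as the power -1.
  have h := (integrableOn_Ioi_comp_rpow_iff
    (fun t : ℝ => t ^ (a - 1) * Real.exp (-(r * t))) (p := -1) (by norm_num)).2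
    (integrableOn_rpow_mul_exp_neg ha hr)
  refine h.congr_fun (fun t ht => ?_) measurableSet_Ioi
  have ht0 : (0 : ℝ) < t := ht
  simp only [smul_eq_mul, abs_neg, abs_one, one_mul]
  rw [← mul_assoc, ← Real.rpow_mul ht0.le, ← Real.rpow_add ht0, Real.rpow_neg_one, div_eq_mul_inv]
  congr 2
  ring

lemma integral_rpow_mul_exp_neg_div {a r : ℝ} (ha : 0 < a) (hr : 0 < r) :
    ∫ t in Set.Ioi (0 : ℝ), t ^ (-a - 1) * Real.exp (-(r / t)) = (1 / r) ^ a * Real.Gamma a := by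
  rw [← Real.integral_rpow_mul_exp_neg_mul_Ioi ha hr,
    ← integral_comp_rpow_Ioi (fun t : ℝ => t ^ (a - 1) * Real.exp (-(r * t))) (p := -1)
      (by norm_num)]
  refine setIntegral_congr_fun measurableSet_Ioi fun t ht => ?_
  have ht0 : (0 : ℝ) < t := ht
  simp only [smul_eq_mul, abs_neg, abs_one, one_mul]
  rw [← mul_assoc, ← Real.rpow_mul ht0.le, ← Real.rpow_add ht0, Real.rpow_neg_one, div_eq_mul_inv]
  congr 2
  ring

lemma lintegral_rpow_mul_one_add_rpow_lt_top {a b : ℝ} (ha : 0 < a) (hab : a < b) :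
    ∫⁻ s in Set.Ioi (0 : ℝ), ENNReal.ofReal (s ^ (a - 1) * (1 + s) ^ (-b)) < ⊤ := by
  have hsub : Set.Ioi (0 : ℝ) ⊆ Set.Ioo 0 1 ∪ Set.Ici 1 := fun s hs => by
    rcases lt_or_ge s 1 with h | h
    · exact Or.inl ⟨hs, h⟩
    · exact Or.inr h
  refine (lintegral_mono_set hsub).trans_lt ((lintegral_union_le _ _ _).trans_lt ?_)
  refine ENNReal.add_lt_top.2 ⟨?_, ?_⟩
  · have h : IntegrableOn (fun s : ℝ => s ^ (a - 1)) (Set.Ioo 0 1) :=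
      (intervalIntegral.integrableOn_Ioo_rpow_iff one_pos).2 (by linarith)
    refine lt_of_le_of_lt (setLIntegral_mono' measurableSet_Ioo fun s hs => ?_)
      h.lintegral_lt_top
    have hs0 : 0 < s := hs.1
    refine ENNReal.ofReal_le_ofReal (mul_le_of_le_one_right (by positivity) ?_)
    exact Real.rpow_le_one_of_one_le_of_nonpos (by linarith) (by linarith)
  · have h : IntegrableOn (fun s : ℝ => s ^ (a - 1 - b)) (Set.Ici 1) :=
      (integrableOn_Ici_iff_integrableOn_Ioi).2
        (integrableOn_Ioi_rpow_of_lt (by linarith) one_pos)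
    refine lt_of_le_of_lt (setLIntegral_mono' measurableSet_Ici fun s hs => ?_)
      h.lintegral_lt_top
    have hs0 : (0 : ℝ) < s := one_pos.trans_le hs
    refine ENNReal.ofReal_le_ofReal ?_
    rw [sub_eq_add_neg _ b, Real.rpow_add hs0]
    refine mul_le_mul_of_nonneg_left ?_ (by positivity)
    exact Real.rpow_le_rpow_of_nonpos hs0 (by linarith) (by linarith)

/-! ### Integrability of the Fourier transform of `‖ξ‖^α exp (-π ‖ξ‖²)` -/

open scoped FourierTransform RealInnerProductSpace

lemma fourier_comp_smul {n : ℕ} (Q : Rn n → ℂ) {R : ℝ} (hR : 0 < R) (x : Rn n) :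
    𝓕 (fun ξ => Q (R • ξ)) x = ((R ^ n)⁻¹ : ℝ) • 𝓕 Q (R⁻¹ • x) := by
  rw [Real.fourier_eq, Real.fourier_eq]
  have h := Measure.integral_comp_smul (volume : Measure (Rn n))
    (fun v => Real.fourierChar (-⟪v, R⁻¹ • x⟫) • Q v) R
  rw [finrank_euclideanSpace_fin, abs_of_pos (by positivity)] at h
  rw [← h]
  congr 1 with v
  rw [inner_smul_left, inner_smul_right]
  simp [hR.ne']

/-- The function `‖ξ‖^α exp (-π ‖ξ‖²)`. -/
noncomputable def fracGaussian (n : ℕ) (α : ℝ) (ξ : Rn n) : ℂ :=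
  ((‖ξ‖ ^ α * Real.exp (-Real.pi * ‖ξ‖ ^ 2) : ℝ) : ℂ)

lemma continuous_fracGaussian (n : ℕ) {α : ℝ} (hα : 0 < α) : Continuous (fracGaussian n α) := by
  unfold fracGaussian
  have : Continuous fun ξ : Rn n => ‖ξ‖ ^ α := continuous_norm.rpow_const fun _ => Or.inr hα.le
  fun_prop

lemma integrable_fracGaussian (n : ℕ) {α : ℝ} (hα : 0 < α) : Integrable (fracGaussian n α) := by
  obtain ⟨k, hk⟩ := exists_nat_ge α
  have h := (gaussianMoment n 0).integrable (μ := volume).norm.add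
    ((gaussianMoment n k).integrable (μ := volume)).norm
  refine h.mono' (continuous_fracGaussian n hα).aestronglyMeasurable
    (Filter.Eventually.of_forall fun ξ => ?_)
  simp only [Pi.add_apply, gaussianMoment_apply, fracGaussian, Complex.norm_real, pow_zero, one_mul]
  rw [Real.norm_of_nonneg (by positivity), Real.norm_of_nonneg (by positivity),
    Real.norm_of_nonneg (by positivity), ← one_add_mul]
  gcongr
  rcases le_or_gt ‖ξ‖ 1 with h1 | h1
  · exact (Real.rpow_le_one (norm_nonneg _) h1 hα.le).trans (le_add_of_nonneg_right (by positivity))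
  · refine le_add_of_nonneg_of_le zero_le_one ?_
    rw [← pow_mul, ← Real.rpow_natCast]
    refine Real.rpow_le_rpow_of_exponent_le h1.le ?_
    push_cast
    linarith

/-- The rescaled Gaussian moments `‖ξ‖^(2k) exp (-π (1 + s) ‖ξ‖²)`. -/
noncomputable def scaledMoment (n k : ℕ) (s : ℝ) (ξ : Rn n) : ℝ :=
  (‖ξ‖ ^ 2) ^ k * Real.exp (-Real.pi * (1 + s) * ‖ξ‖ ^ 2)

/-- The scaled moment is (1+s)^(-k) times the Schwartz function `gaussianMoment` dilated by √(1+s).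
Dilation preserves the L¹ norm of the transform, which therefore decays like (1+s)^(-k). -/
lemma fourier_scaledMoment (n k : ℕ) {s : ℝ} (hs : 0 < s) (x : Rn n) :
    𝓕 (fun ξ => (scaledMoment n k s ξ : ℂ)) x =
      (((1 + s) ^ k)⁻¹ * (√(1 + s) ^ n)⁻¹ : ℝ) •
        (𝓕 (gaussianMoment n k) : SchwartzMap (Rn n) ℂ) ((√(1 + s))⁻¹ • x) := by
  have hR : 0 < √(1 + s) := Real.sqrt_pos.2 (by linarith)
  have hsq : √(1 + s) ^ 2 = 1 + s := Real.sq_sqrt (by linarith)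
  rw [SchwartzMap.fourier_coe, mul_smul, ← fourier_comp_smul _ hR, Real.fourier_eq,
    Real.fourier_eq, ← integral_smul]
  congr 1 with ξ
  rw [smul_comm]
  congr 1
  rw [gaussianMoment_apply, scaledMoment, norm_smul, Real.norm_of_nonneg hR.le, mul_pow, hsq,
    Complex.real_smul, ← Complex.ofReal_mul]
  congr 1
  have : (1 + s) ^ k ≠ 0 := by positivity
  rw [mul_pow, ← mul_assoc (-Real.pi), mul_assoc ((1 + s) ^ k), inv_mul_cancel_left₀ this]

/-- Write |ξ|^α = |ξ|^(2k) |ξ|^(α-2k) and express the negative power by a Gamma integral of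
Gaussians. This trades the nonsmooth weight for smooth ones; k > α/2 makes the integral converge at
0. -/
lemma fracGaussian_eq_integral {n k : ℕ} {α : ℝ} (hα : 0 < α) (hk : α / 2 < k) (ξ : Rn n) :
    IntegrableOn (fun s : ℝ => s ^ (k - α / 2 - 1) * scaledMoment n k s ξ) (Set.Ioi 0) ∧
    ∫ s in Set.Ioi (0 : ℝ), s ^ (k - α / 2 - 1) * scaledMoment n k s ξ =
      (1 / Real.pi) ^ (k - α / 2) * Real.Gamma (k - α / 2) *
        (‖ξ‖ ^ α * Real.exp (-Real.pi * ‖ξ‖ ^ 2)) := by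
  have hβ : 0 < k - α / 2 := by linarith
  rcases eq_or_ne ξ 0 with rfl | hξ
  · have hk0 : k ≠ 0 := by
      rintro rfl
      simp only [Nat.cast_zero] at hk
      linarith
    simp [scaledMoment, hk0, Real.zero_rpow hα.ne']
  have hpos : 0 < ‖ξ‖ := norm_pos_iff.2 hξ
  have heq : (fun s : ℝ => s ^ (k - α / 2 - 1) * scaledMoment n k s ξ) = fun s =>
      ((‖ξ‖ ^ 2) ^ k * Real.exp (-Real.pi * ‖ξ‖ ^ 2)) *
        (s ^ (k - α / 2 - 1) * Real.exp (-(Real.pi * ‖ξ‖ ^ 2 * s))) := by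
    ext s
    have : Real.exp (-Real.pi * (1 + s) * ‖ξ‖ ^ 2)
        = Real.exp (-Real.pi * ‖ξ‖ ^ 2) * Real.exp (-(Real.pi * ‖ξ‖ ^ 2 * s)) := by
      rw [← Real.exp_add]; ring_nf
    rw [scaledMoment, this]; ring
  have hr : 0 < Real.pi * ‖ξ‖ ^ 2 := by positivity
  rw [heq]
  refine ⟨(integrableOn_rpow_mul_exp_neg hβ hr).const_mul _, ?_⟩
  rw [integral_const_mul, Real.integral_rpow_mul_exp_neg_mul_Ioi hβ hr]
  have e1 : (1 / (Real.pi * ‖ξ‖ ^ 2)) ^ (k - α / 2)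
      = (1 / Real.pi) ^ (k - α / 2) * (‖ξ‖ ^ (2 * k - α))⁻¹ := by
    rw [← one_div_mul_one_div, Real.mul_rpow (by positivity) (by positivity), one_div (‖ξ‖ ^ 2),
      Real.inv_rpow (by positivity), ← Real.rpow_natCast, ← Real.rpow_mul hpos.le]
    congr 3
    push_cast; ring
  have e2 : (‖ξ‖ ^ 2) ^ k * (‖ξ‖ ^ (2 * k - α))⁻¹ = ‖ξ‖ ^ α := by
    rw [← pow_mul, ← Real.rpow_natCast, ← Real.rpow_neg hpos.le, ← Real.rpow_add hpos]
    congr 1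
    push_cast; ring
  rw [e1, ← e2]
  ring

lemma enorm_fourier_fracGaussian_le {n k : ℕ} {α : ℝ} (hα : 0 < α) (hk : α / 2 < k) (x : Rn n) :
    ‖𝓕 (fracGaussian n α) x‖ₑ ≤
      ‖((1 / Real.pi) ^ (k - α / 2) * Real.Gamma (k - α / 2))⁻¹‖ₑ *
      ∫⁻ s in Set.Ioi (0 : ℝ), ENNReal.ofReal (s ^ (k - α / 2 - 1)) *
        ‖𝓕 (fun ξ => (scaledMoment n k s ξ : ℂ)) x‖ₑ := by
  have hβ : 0 < k - α / 2 := by linarith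
  set c := (1 / Real.pi) ^ (k - α / 2) * Real.Gamma (k - α / 2) with hc
  have hc0 : 0 < c := mul_pos (by positivity) (Real.Gamma_pos_of_pos hβ)
  have hmeas : AEStronglyMeasurable (fun w : Rn n × ℝ =>
      (Real.fourierChar (-⟪w.1, x⟫) : ℂ) *
        ((w.2 ^ (k - α / 2 - 1) * scaledMoment n k w.2 w.1 : ℝ) : ℂ))
      (volume.prod (volume.restrict (Set.Ioi 0))) := by
    refine AEStronglyMeasurable.mul ?_ ?_
    · have : Continuous fun w : Rn n × ℝ => (Real.fourierChar (-⟪w.1, x⟫) : ℂ) :=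
        continuous_subtype_val.comp (Real.continuous_fourierChar.comp (by fun_prop))
      exact this.aestronglyMeasurable
    · unfold scaledMoment
      exact Measurable.aestronglyMeasurable (by fun_prop)
  have hnn : ∀ (ξ : Rn n), ∀ s ∈ Set.Ioi (0 : ℝ),
      ‖(Real.fourierChar (-⟪ξ, x⟫) : ℂ) * ((s ^ (k - α / 2 - 1) * scaledMoment n k s ξ : ℝ) : ℂ)‖
        = s ^ (k - α / 2 - 1) * scaledMoment n k s ξ := by
    intro ξ s hs
    have : (0 : ℝ) < s := hs
    rw [norm_mul, Circle.norm_coe, one_mul, Complex.norm_real, Real.norm_of_nonneg]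
    unfold scaledMoment
    positivity
  have hint : Integrable (fun w : Rn n × ℝ => (Real.fourierChar (-⟪w.1, x⟫) : ℂ) *
        ((w.2 ^ (k - α / 2 - 1) * scaledMoment n k w.2 w.1 : ℝ) : ℂ))
      (volume.prod (volume.restrict (Set.Ioi 0))) := by
    refine (integrable_prod_iff hmeas).2 ⟨Filter.Eventually.of_forall fun ξ => ?_, ?_⟩
    · have h : Integrable (fun s : ℝ => ((s ^ (k - α / 2 - 1) * scaledMoment n k s ξ : ℝ) : ℂ))
          (volume.restrict (Set.Ioi 0)) := (fracGaussian_eq_integral hα hk ξ).1.ofReal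
      exact h.const_mul (Real.fourierChar (-⟪ξ, x⟫) : ℂ)
    · refine ((integrable_fracGaussian n hα).norm.const_mul c).congr
        (Filter.Eventually.of_forall fun ξ => ?_)
      simp only
      rw [setIntegral_congr_fun measurableSet_Ioi (hnn ξ), (fracGaussian_eq_integral hα hk ξ).2,
        fracGaussian, Complex.norm_real, Real.norm_of_nonneg (by positivity)]
  have hF : 𝓕 (fracGaussian n α) x = (c⁻¹ : ℝ) • ∫ s in Set.Ioi (0 : ℝ),
      ((s ^ (k - α / 2 - 1) : ℝ) : ℂ) • 𝓕 (fun ξ => (scaledMoment n k s ξ : ℂ)) x := by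
    calc 𝓕 (fracGaussian n α) x
        = ∫ ξ, (c⁻¹ : ℝ) • ∫ s in Set.Ioi (0 : ℝ), (Real.fourierChar (-⟪ξ, x⟫) : ℂ) *
            ((s ^ (k - α / 2 - 1) * scaledMoment n k s ξ : ℝ) : ℂ) := by
          rw [Real.fourier_eq]
          congr 1 with ξ
          rw [integral_const_mul, integral_complex_ofReal, (fracGaussian_eq_integral hα hk ξ).2,
            fracGaussian, Circle.smul_def, smul_eq_mul, ← mul_smul_comm, Complex.real_smul,
            ← Complex.ofReal_mul, inv_mul_cancel_left₀ hc0.ne']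
      _ = (c⁻¹ : ℝ) • ∫ s in Set.Ioi (0 : ℝ), ∫ ξ, (Real.fourierChar (-⟪ξ, x⟫) : ℂ) *
            ((s ^ (k - α / 2 - 1) * scaledMoment n k s ξ : ℝ) : ℂ) := by
          rw [integral_smul, integral_integral_swap hint]
      _ = _ := by
          congr 2 with s
          rw [Real.fourier_eq, ← integral_smul]
          congr 1 with ξ
          rw [Circle.smul_def, Complex.ofReal_mul, smul_eq_mul, smul_eq_mul]; ring
  rw [hF, enorm_smul]
  gcongr
  refine (enorm_integral_le_lintegral_enorm _).trans_eq ?_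
  refine setLIntegral_congr_fun measurableSet_Ioi fun s hs => ?_
  have : (0 : ℝ) < s := hs
  rw [enorm_smul, ← ofReal_norm, Complex.norm_real, Real.norm_of_nonneg (by positivity)]

/-- The L¹ norms of the slices sum to a multiple of ∫ s^(k-α/2-1) (1+s)^(-k) ds, finite because 0 <
k - α/2 < k. -/
lemma integrable_fourier_fracGaussian (n : ℕ) {α : ℝ} (hα : 0 < α) :
    Integrable (𝓕 (fracGaussian n α)) := by
  obtain ⟨k, hk⟩ := exists_nat_gt (α / 2)
  have hβ : 0 < k - α / 2 := by linarith
  have hcont : Continuous (𝓕 (fracGaussian n α)) :=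
    VectorFourier.fourierIntegral_continuous Real.continuous_fourierChar
      (by exact continuous_inner) (integrable_fracGaussian n hα)
  refine ⟨hcont.aestronglyMeasurable, ?_⟩
  set Q : SchwartzMap (Rn n) ℂ := 𝓕 (gaussianMoment n k) with hQ
  have hQc : Continuous Q := Q.continuous
  rw [hasFiniteIntegral_iff_enorm]
  refine (lintegral_mono fun x => enorm_fourier_fracGaussian_le hα hk x).trans_lt ?_
  rw [lintegral_const_mul' _ _ enorm_ne_top]
  refine ENNReal.mul_lt_top enorm_lt_top ?_
  have hcongr : ∀ x : Rn n, ∫⁻ s in Set.Ioi (0 : ℝ), ENNReal.ofReal (s ^ (k - α / 2 - 1)) *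
        ‖𝓕 (fun ξ => (scaledMoment n k s ξ : ℂ)) x‖ₑ
      = ∫⁻ s in Set.Ioi (0 : ℝ), ENNReal.ofReal (s ^ (k - α / 2 - 1)) *
        ‖(((1 + s) ^ k)⁻¹ * (√(1 + s) ^ n)⁻¹ : ℝ) • Q ((√(1 + s))⁻¹ • x)‖ₑ := fun x =>
    setLIntegral_congr_fun measurableSet_Ioi fun s hs => by
      simp only [fourier_scaledMoment n k hs x, hQ]
  simp_rw [hcongr]
  rw [lintegral_lintegral_swap]
  swap
  · have h1 : Measurable fun w : Rn n × ℝ => √(1 + w.2) :=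
      Real.continuous_sqrt.measurable.comp (by fun_prop)
    have h2 : Measurable fun w : Rn n × ℝ => Q ((√(1 + w.2))⁻¹ • w.1) :=
      hQc.measurable.comp (h1.inv.smul measurable_fst)
    have h3 : Measurable fun w : Rn n × ℝ => (((1 + w.2) ^ k)⁻¹ * (√(1 + w.2) ^ n)⁻¹ : ℝ) :=
      Measurable.mul (by fun_prop) (h1.pow_const n).inv
    exact (Measurable.mul (by fun_prop) (h3.smul h2).enorm).aemeasurable
  have hinner : ∀ s ∈ Set.Ioi (0 : ℝ), ∫⁻ x : Rn n, ENNReal.ofReal (s ^ (k - α / 2 - 1)) *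
        ‖(((1 + s) ^ k)⁻¹ * (√(1 + s) ^ n)⁻¹ : ℝ) • Q ((√(1 + s))⁻¹ • x)‖ₑ
      = ENNReal.ofReal (s ^ (k - α / 2 - 1) * (1 + s) ^ (-(k : ℝ))) * ∫⁻ x, ‖Q x‖ₑ := by
    intro s hs
    have hs0 : (0 : ℝ) < s := hs
    have hR : 0 < √(1 + s) := Real.sqrt_pos.2 (by linarith)
    simp_rw [enorm_smul]
    rw [lintegral_const_mul' _ _ ENNReal.ofReal_ne_top, lintegral_const_mul' _ _ enorm_ne_top,
      lintegral_eq_mul_lintegral_smul _ hR, Real.enorm_of_nonneg (by positivity)]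
    simp_rw [inv_smul_smul₀ hR.ne']
    rw [← mul_assoc, ← mul_assoc, ← ENNReal.ofReal_mul (by positivity),
      ← ENNReal.ofReal_mul (by positivity), Real.rpow_neg (by positivity), Real.rpow_natCast]
    congr 2
    field_simp
  rw [setLIntegral_congr_fun measurableSet_Ioi hinner, lintegral_mul_const']
  · exact ENNReal.mul_lt_top (lintegral_rpow_mul_one_add_rpow_lt_top hβ (by linarith))
      Q.integrable.2
  · exact (Q.integrable (μ := volume)).2.ne

/-! ### The Gaussian as a Riesz potential -/

lemma memLp_of_integrable_of_bound {X : Type*} [MeasurableSpace X] {μ : Measure X} {g : X → ℝ}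
    (hg : Integrable g μ) {C : ℝ} (hC : ∀ x, ‖g x‖ ≤ C) {p : ℝ} (hp : 1 ≤ p) :
    MemLp g (ENNReal.ofReal p) μ := by
  have hp0 : 0 < p := by linarith
  refine ⟨hg.1, ?_⟩
  rw [eLpNorm_lt_top_iff_lintegral_rpow_enorm_lt_top (by simpa using hp0) ENNReal.ofReal_ne_top,
    ENNReal.toReal_ofReal hp0.le]
  have hCtop : ENNReal.ofReal C ^ (p - 1) ≠ ⊤ :=
    ENNReal.rpow_ne_top_of_nonneg (by linarith) ENNReal.ofReal_ne_top
  calc ∫⁻ x, ‖g x‖ₑ ^ p ∂μ ≤ ∫⁻ x, ENNReal.ofReal C ^ (p - 1) * ‖g x‖ₑ ∂μ := by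
        refine lintegral_mono fun x => ?_
        have : ‖g x‖ₑ ^ p = ‖g x‖ₑ ^ (p - 1) * ‖g x‖ₑ := by
          conv_rhs => rw [← ENNReal.rpow_one (‖g x‖ₑ)]
          rw [← ENNReal.rpow_mul, one_mul,
            ← ENNReal.rpow_add_of_nonneg _ _ (by linarith) zero_le_one, sub_add_cancel]
        rw [this]
        gcongr
        rw [← ofReal_norm]
        exact ENNReal.ofReal_le_ofReal (hC x)
    _ < ⊤ := by
        rw [lintegral_const_mul' _ _ hCtop]
        exact ENNReal.mul_lt_top hCtop.lt_top hg.2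

/-- Near x the kernel is integrable and g bounded; away from x the kernel is at most 1 and g
integrable. -/
lemma integrable_kernel_mul {n : ℕ} (hn : 1 ≤ n) {α : ℝ} (hα : 0 < α) (hαn : α < n)
    {g : Rn n → ℂ} (hg : Integrable g) {C : ℝ} (hC : ∀ y, ‖g y‖ ≤ C) (x : Rn n) :
    Integrable fun y => ((‖x - y‖ ^ (α - n) : ℝ) : ℂ) * g y := by
  have h1 : IntegrableOn (fun z : Rn n => ‖z‖ ^ (α - n)) (Metric.ball 0 1) := by
    refine integrableOn_ball_of_norm_le_rpow (C := 1) (α := n - α) (by simpa using hn)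
      (by simpa using hα) (Filter.Eventually.of_forall fun z => ?_) ?_
    · rw [Real.norm_of_nonneg (by positivity), one_mul, neg_sub]
    · exact (measurable_norm.pow_const _).aestronglyMeasurable
  have h2 := ((integrable_indicator_iff Metric.isOpen_ball.measurableSet).2 h1).comp_sub_left x
  have hC0 : 0 ≤ C := (norm_nonneg _).trans (hC 0)
  refine ((h2.const_mul C).add hg.norm).mono' ?_ (Filter.Eventually.of_forall fun y => ?_)
  · exact AEStronglyMeasurable.mul (Measurable.aestronglyMeasurable (by fun_prop)) hg.1
  rw [norm_mul, Complex.norm_real, Real.norm_of_nonneg (by positivity)]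
  simp only [Pi.add_apply]
  by_cases hy : x - y ∈ Metric.ball (0 : Rn n) 1
  · rw [Set.indicator_of_mem hy, mul_comm]
    exact le_add_of_le_of_nonneg (mul_le_mul_of_nonneg_right (hC y) (by positivity))
      (norm_nonneg _)
  · rw [Set.indicator_of_notMem hy, mul_zero, zero_add]
    rw [mem_ball_zero_iff, not_lt] at hy
    exact mul_le_of_le_one_left (norm_nonneg _)
      (Real.rpow_le_one_of_one_le_of_nonpos hy (by linarith))

/-- The modulated Gaussian `exp (-b ‖ξ‖² + 2πi ⟪x, ξ⟫)`. -/
noncomputable def modGaussian {n : ℕ} (b : ℝ) (x ξ : Rn n) : ℂ :=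
  Complex.exp (-(b : ℂ) * (‖ξ‖ : ℂ) ^ 2 + 2 * Real.pi * Complex.I * (⟪x, ξ⟫ : ℝ))

lemma integrable_modGaussian {n : ℕ} {b : ℝ} (hb : 0 < b) (x : Rn n) :
    Integrable (modGaussian b x) :=
  GaussianFourier.integrable_cexp_neg_mul_sq_norm_add (by simpa using hb) _ x

lemma fourier_modGaussian {n : ℕ} {b : ℝ} (hb : 0 < b) (x w : Rn n) :
    𝓕 (modGaussian b x) w =
      (((Real.pi / b) ^ ((n : ℝ) / 2) * Real.exp (-Real.pi ^ 2 * ‖x - w‖ ^ 2 / b) : ℝ) : ℂ) := by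
  have h := fourier_gaussian_innerProductSpace' (b := (b : ℂ)) (by simpa using hb) x w
  unfold modGaussian
  rw [h, finrank_euclideanSpace_fin, Complex.ofReal_mul, Complex.ofReal_cpow (by positivity)]
  push_cast
  rfl

lemma integral_modGaussian_pi {n : ℕ} (x : Rn n) :
    ∫ ξ, modGaussian Real.pi x ξ = (Real.exp (-Real.pi * ‖x‖ ^ 2) : ℂ) := by
  have h := fourier_modGaussian Real.pi_pos x 0
  rw [Real.fourier_eq] at h
  simp only [inner_zero_right, neg_zero, AddChar.map_zero_eq_one, one_smul, sub_zero] at h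
  rw [h, div_self Real.pi_ne_zero, Real.one_rpow, one_mul, Complex.ofReal_exp, Complex.ofReal_exp]
  congr 2
  have := Real.pi_ne_zero
  field_simp

lemma modGaussian_mul_fracGaussian {n : ℕ} (α b : ℝ) (x ξ : Rn n) :
    modGaussian b x ξ * fracGaussian n α ξ =
      ((‖ξ‖ ^ α * Real.exp (-(b * ‖ξ‖ ^ 2)) : ℝ) : ℂ) * modGaussian Real.pi x ξ := by
  simp only [modGaussian, fracGaussian, Complex.ofReal_mul, Complex.ofReal_exp]
  rw [mul_left_comm, mul_assoc ((‖ξ‖ ^ α : ℝ) : ℂ), ← Complex.exp_add, ← Complex.exp_add]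
  congr 2
  push_cast
  ring

lemma continuous_modGaussian {n : ℕ} (b : ℝ) (x : Rn n) : Continuous (modGaussian b x) := by
  unfold modGaussian
  fun_prop

/-- The inverse Fourier transform of `‖ξ‖^α exp (-π ‖ξ‖²)`: a multiple of the fractional Laplacian
of order `α / 2` of the Gaussian. -/
noncomputable def fracLaplaceGaussian (n : ℕ) (α : ℝ) : Rn n → ℂ := 𝓕⁻ (fracGaussian n α)

lemma integrable_fracLaplaceGaussian (n : ℕ) {α : ℝ} (hα : 0 < α) :
    Integrable (fracLaplaceGaussian n α) := by
  have h := (integrable_fourier_fracGaussian n hα).comp_neg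
  refine h.congr (Filter.Eventually.of_forall fun x => ?_)
  exact (Real.fourierInv_eq_fourier_neg _ _).symm

lemma fourier_fracLaplaceGaussian (n : ℕ) {α : ℝ} (hα : 0 < α) :
    𝓕 (fracLaplaceGaussian n α) = fracGaussian n α :=
  (continuous_fracGaussian n hα).fourier_fourierInv_eq (integrable_fracGaussian n hα)
    (integrable_fourier_fracGaussian n hα)

lemma norm_fracLaplaceGaussian_le (n : ℕ) (α : ℝ) (x : Rn n) :
    ‖fracLaplaceGaussian n α x‖ ≤ ∫ ξ, ‖fracGaussian n α ξ‖ := by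
  rw [fracLaplaceGaussian, Real.fourierInv_eq_fourier_neg]
  exact VectorFourier.norm_fourierIntegral_le_integral_norm _ _ _ _ _

/-- Convolution of the heat kernel with the fractional Laplacian of the Gaussian. -/
lemma integral_exp_mul_fracLaplaceGaussian {n : ℕ} {α : ℝ} (hα : 0 < α) {u : ℝ} (hu : 0 < u)
    (x : Rn n) :
    ∫ y, (Real.exp (-(Real.pi * ‖x - y‖ ^ 2 * u)) : ℂ) * fracLaplaceGaussian n α y =
      ((u ^ (-((n : ℝ) / 2)) : ℝ) : ℂ) *
        ∫ ξ, ((‖ξ‖ ^ α * Real.exp (-(Real.pi * ‖ξ‖ ^ 2 / u)) : ℝ) : ℂ) *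
          modGaussian Real.pi x ξ := by
  have hb : 0 < Real.pi / u := by positivity
  -- Multiplication formula ∫ F̂ G = ∫ F Ĝ. The width π/u is chosen so that the transform of the
  -- modulated Gaussian is a multiple of e^(-πu|x-y|²).
  have hswap : ∫ y, 𝓕 (modGaussian (Real.pi / u) x) y • fracLaplaceGaussian n α y
      = ∫ ξ, modGaussian (Real.pi / u) x ξ • 𝓕 (fracLaplaceGaussian n α) ξ := by
    have h := VectorFourier.integral_fourierIntegral_smul_eq_flip (L := innerₗ (Rn n))
      (μ := volume) (ν := volume) Real.continuous_fourierChar (by exact continuous_inner)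
      (integrable_modGaussian hb x) (integrable_fracLaplaceGaussian n hα)
    rwa [flip_innerₗ] at h
  have hleft : ∀ y, (Real.exp (-(Real.pi * ‖x - y‖ ^ 2 * u)) : ℂ) * fracLaplaceGaussian n α y
      = ((u ^ (-((n : ℝ) / 2)) : ℝ) : ℂ) *
        (𝓕 (modGaussian (Real.pi / u) x) y • fracLaplaceGaussian n α y) := by
    intro y
    rw [fourier_modGaussian hb, smul_eq_mul, ← mul_assoc, ← Complex.ofReal_mul]
    congr 2
    have e1 : Real.pi / (Real.pi / u) = u := by field_simp
    have e2 : -Real.pi ^ 2 * ‖x - y‖ ^ 2 / (Real.pi / u) = -(Real.pi * ‖x - y‖ ^ 2 * u) := by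
      field_simp
    rw [e1, e2, ← mul_assoc, ← Real.rpow_add hu, neg_add_cancel, Real.rpow_zero, one_mul]
  simp_rw [hleft]
  rw [integral_const_mul, hswap, fourier_fracLaplaceGaussian n hα]
  congr 2 with ξ
  rw [smul_eq_mul, modGaussian_mul_fracGaussian, div_mul_eq_mul_div]

lemma ae_ne_of_one_le {n : ℕ} (hn : 1 ≤ n) (x : Rn n) : ∀ᵐ y : Rn n, y ≠ x := by
  have : Nontrivial (Rn n) := Module.nontrivial_of_finrank_pos (R := ℝ)
    (by rw [finrank_euclideanSpace_fin]; omega)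
  exact Measure.ae_ne volume x

lemma integral_kernel_gamma {n : ℕ} {α : ℝ} (hαn : α < n) {r : ℝ} (hr : 0 < r) :
    ∫ u in Set.Ioi (0 : ℝ), u ^ ((n - α) / 2 - 1) * Real.exp (-(Real.pi * r ^ 2 * u)) =
      (1 / Real.pi) ^ ((n - α) / 2) * Real.Gamma ((n - α) / 2) * r ^ (α - n) := by
  rw [Real.integral_rpow_mul_exp_neg_mul_Ioi (by linarith) (by positivity),
    ← one_div_mul_one_div, Real.mul_rpow (by positivity) (by positivity), one_div (r ^ 2),
    Real.inv_rpow (by positivity), ← Real.rpow_natCast, ← Real.rpow_mul hr.le,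
    ← Real.rpow_neg hr.le]
  have : -(((2 : ℕ) : ℝ) * ((n - α) / 2)) = α - n := by push_cast; ring
  rw [this]
  ring

/-- The value does not depend on r: the u-integral produces r^(-α), exactly cancelling the weight.
-/
lemma integral_frac_gamma {α : ℝ} (hα : 0 < α) {r : ℝ} (hr : 0 < r) :
    ∫ u in Set.Ioi (0 : ℝ), r ^ α * (u ^ (-(α / 2) - 1) * Real.exp (-(Real.pi * r ^ 2 / u))) =
      (1 / Real.pi) ^ (α / 2) * Real.Gamma (α / 2) := by
  rw [integral_const_mul, integral_rpow_mul_exp_neg_div (by linarith) (by positivity),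
    ← one_div_mul_one_div, Real.mul_rpow (by positivity) (by positivity), one_div (r ^ 2),
    Real.inv_rpow (by positivity), ← Real.rpow_natCast, ← Real.rpow_mul hr.le,
    ← Real.rpow_neg hr.le]
  have : -(((2 : ℕ) : ℝ) * (α / 2)) = -α := by push_cast; ring
  rw [this]
  have : r ^ α * r ^ (-α) = 1 := by rw [← Real.rpow_add hr, add_neg_cancel, Real.rpow_zero]
  linear_combination ((1 / Real.pi) ^ (α / 2) * Real.Gamma (α / 2)) * this

/-- Subordinate the Riesz kernel to heat kernels, pass to the frequency side at each u, and
integrate in u again. There |ξ|^α is cancelled, and the remaining modulated Gaussian integrates to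
the Gaussian at x. The nonintegrable kernel itself is never transformed. -/
lemma integral_kernel_mul_fracLaplaceGaussian {n : ℕ} (hn : 1 ≤ n) {α : ℝ} (hα : 0 < α)
    (hαn : α < n) (x : Rn n) :
    (((1 / Real.pi) ^ ((n - α) / 2) * Real.Gamma ((n - α) / 2) : ℝ) : ℂ) *
        ∫ y, ((‖x - y‖ ^ (α - n) : ℝ) : ℂ) * fracLaplaceGaussian n α y =
      (((1 / Real.pi) ^ (α / 2) * Real.Gamma (α / 2) * Real.exp (-Real.pi * ‖x‖ ^ 2) : ℝ) : ℂ) := by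
  set g := fracLaplaceGaussian n α with hg
  have hgint : Integrable g := integrable_fracLaplaceGaussian n hα
  have hγ : 0 < (n - α) / 2 := by linarith
  set cγ := (1 / Real.pi) ^ ((n - α) / 2) * Real.Gamma ((n - α) / 2) with hcγ
  have hae : ∀ᵐ y : Rn n, 0 < ‖x - y‖ := by
    filter_upwards [ae_ne_of_one_le hn x] with y hy
    exact norm_pos_iff.2 (sub_ne_zero.2 hy.symm)
  have hae0 : ∀ᵐ ξ : Rn n, 0 < ‖ξ‖ := by
    filter_upwards [ae_ne_of_one_le hn 0] with ξ hξ
    exact norm_pos_iff.2 hξ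
  have hW : Integrable (fun w : Rn n × ℝ =>
      ((w.2 ^ ((n - α) / 2 - 1) * Real.exp (-(Real.pi * ‖x - w.1‖ ^ 2 * w.2)) : ℝ) : ℂ) * g w.1)
      (volume.prod (volume.restrict (Set.Ioi 0))) := by
    have hm : AEStronglyMeasurable (fun w : Rn n × ℝ =>
      ((w.2 ^ ((n - α) / 2 - 1) * Real.exp (-(Real.pi * ‖x - w.1‖ ^ 2 * w.2)) : ℝ) : ℂ) * g w.1)
      (volume.prod (volume.restrict (Set.Ioi 0))) :=
      AEStronglyMeasurable.mul (Measurable.aestronglyMeasurable (by fun_prop)) hgint.1.comp_fst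
    refine (integrable_prod_iff hm).2 ⟨?_, ?_⟩
    · filter_upwards [hae] with y hy
      have h : Integrable (fun u : ℝ =>
          ((u ^ ((n - α) / 2 - 1) * Real.exp (-(Real.pi * ‖x - y‖ ^ 2 * u)) : ℝ) : ℂ))
          (volume.restrict (Set.Ioi 0)) :=
        (integrableOn_rpow_mul_exp_neg hγ (by positivity : 0 < Real.pi * ‖x - y‖ ^ 2)).ofReal
      exact h.mul_const (g y)
    · refine (((integrable_kernel_mul hn hα hαn hgint
        (norm_fracLaplaceGaussian_le n α) x).norm).const_mul cγ).congr ?_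
      filter_upwards [hae] with y hy
      have : ∀ u ∈ Set.Ioi (0 : ℝ),
          ‖((u ^ ((n - α) / 2 - 1) * Real.exp (-(Real.pi * ‖x - y‖ ^ 2 * u)) : ℝ) : ℂ) * g y‖
          = (u ^ ((n - α) / 2 - 1) * Real.exp (-(Real.pi * ‖x - y‖ ^ 2 * u))) * ‖g y‖ := by
        intro u hu
        have : (0 : ℝ) < u := hu
        rw [norm_mul, Complex.norm_real, Real.norm_of_nonneg (by positivity)]
      rw [setIntegral_congr_fun measurableSet_Ioi this, integral_mul_const,
        integral_kernel_gamma hαn hy, norm_mul, Complex.norm_real,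
        Real.norm_of_nonneg (by positivity)]
      ring
  have hnorm : ∀ ξ : Rn n, ∀ u ∈ Set.Ioi (0 : ℝ),
      ‖((‖ξ‖ ^ α * (u ^ (-(α / 2) - 1) * Real.exp (-(Real.pi * ‖ξ‖ ^ 2 / u))) : ℝ) : ℂ) *
        modGaussian Real.pi x ξ‖ =
      ‖ξ‖ ^ α * (u ^ (-(α / 2) - 1) * Real.exp (-(Real.pi * ‖ξ‖ ^ 2 / u))) *
        ‖modGaussian Real.pi x ξ‖ := by
    intro ξ u hu
    have : (0 : ℝ) < u := hu
    rw [norm_mul, Complex.norm_real, Real.norm_of_nonneg (by positivity)]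
  have hZ : Integrable (fun w : Rn n × ℝ =>
      ((‖w.1‖ ^ α * (w.2 ^ (-(α / 2) - 1) * Real.exp (-(Real.pi * ‖w.1‖ ^ 2 / w.2))) : ℝ) : ℂ) *
        modGaussian Real.pi x w.1) (volume.prod (volume.restrict (Set.Ioi 0))) := by
    have hm : AEStronglyMeasurable (fun w : Rn n × ℝ =>
        ((‖w.1‖ ^ α * (w.2 ^ (-(α / 2) - 1) * Real.exp (-(Real.pi * ‖w.1‖ ^ 2 / w.2))) : ℝ) : ℂ) *
          modGaussian Real.pi x w.1) (volume.prod (volume.restrict (Set.Ioi 0))) :=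
      AEStronglyMeasurable.mul (Measurable.aestronglyMeasurable (by fun_prop))
        (continuous_modGaussian _ _).aestronglyMeasurable.comp_fst
    refine (integrable_prod_iff hm).2 ⟨?_, ?_⟩
    · filter_upwards [hae0] with ξ hξ
      have h : Integrable (fun u : ℝ =>
          ((‖ξ‖ ^ α * (u ^ (-(α / 2) - 1) * Real.exp (-(Real.pi * ‖ξ‖ ^ 2 / u))) : ℝ) : ℂ))
          (volume.restrict (Set.Ioi 0)) :=
        ((integrableOn_rpow_mul_exp_neg_div (by linarith : 0 < α / 2)
          (by positivity : 0 < Real.pi * ‖ξ‖ ^ 2)).const_mul _).ofReal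
      exact h.mul_const (modGaussian Real.pi x ξ)
    · refine ((integrable_modGaussian Real.pi_pos x).norm.const_mul
        ((1 / Real.pi) ^ (α / 2) * Real.Gamma (α / 2))).congr ?_
      filter_upwards [hae0] with ξ hξ
      rw [setIntegral_congr_fun measurableSet_Ioi (hnorm ξ), integral_mul_const,
        integral_frac_gamma hα hξ]
  calc (cγ : ℂ) * ∫ y, ((‖x - y‖ ^ (α - n) : ℝ) : ℂ) * g y
      = ∫ y, ∫ u in Set.Ioi (0 : ℝ),
          ((u ^ ((n - α) / 2 - 1) * Real.exp (-(Real.pi * ‖x - y‖ ^ 2 * u)) : ℝ) : ℂ) * g y := by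
        rw [← integral_const_mul]
        refine integral_congr_ae ?_
        filter_upwards [hae] with y hy
        rw [integral_mul_const, integral_complex_ofReal, integral_kernel_gamma hαn hy,
          ← hcγ, Complex.ofReal_mul cγ, mul_assoc]
    _ = ∫ u in Set.Ioi (0 : ℝ), ∫ y,
          ((u ^ ((n - α) / 2 - 1) * Real.exp (-(Real.pi * ‖x - y‖ ^ 2 * u)) : ℝ) : ℂ) * g y :=
        integral_integral_swap hW
    _ = ∫ u in Set.Ioi (0 : ℝ), ∫ ξ,
          ((‖ξ‖ ^ α * (u ^ (-(α / 2) - 1) * Real.exp (-(Real.pi * ‖ξ‖ ^ 2 / u))) : ℝ) : ℂ) *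
            modGaussian Real.pi x ξ := by
        refine setIntegral_congr_fun measurableSet_Ioi fun u hu => ?_
        have hu0 : (0 : ℝ) < u := hu
        have hexp : u ^ (-(α / 2) - 1) = u ^ ((n - α) / 2 - 1) * u ^ (-((n : ℝ) / 2)) := by
          rw [← Real.rpow_add hu0]; congr 1; ring
        simp_rw [Complex.ofReal_mul (u ^ ((n - α) / 2 - 1)), mul_assoc]
        have hconv := integral_exp_mul_fracLaplaceGaussian hα hu0 x
        simp_rw [mul_assoc] at hconv
        rw [integral_const_mul, hconv, ← mul_assoc, ← Complex.ofReal_mul, ← hexp,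
          ← integral_const_mul]
        congr 1 with ξ
        push_cast
        ring
    _ = ∫ ξ, ∫ u in Set.Ioi (0 : ℝ),
          ((‖ξ‖ ^ α * (u ^ (-(α / 2) - 1) * Real.exp (-(Real.pi * ‖ξ‖ ^ 2 / u))) : ℝ) : ℂ) *
            modGaussian Real.pi x ξ := (integral_integral_swap hZ).symm
    _ = ∫ ξ, (((1 / Real.pi) ^ (α / 2) * Real.Gamma (α / 2) : ℝ) : ℂ) *
          modGaussian Real.pi x ξ := by
        refine integral_congr_ae ?_
        filter_upwards [hae0] with ξ hξ
        rw [integral_mul_const, integral_complex_ofReal, integral_frac_gamma hα hξ]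
    _ = _ := by
        rw [integral_const_mul, integral_modGaussian_pi, ← Complex.ofReal_mul]

/-- The Gaussian is, up to a positive constant, the Riesz potential of an `L^p` function. -/
lemma exists_rieszPotential_eq_gaussian {n : ℕ} (hn : 1 ≤ n) {α : ℝ} (hα : 0 < α) (hαn : α < n) :
    ∃ (g : Rn n → ℝ) (c : ℝ), 0 < c ∧
      (∀ p : ℝ, 1 ≤ p → MemLp g (ENNReal.ofReal p) volume) ∧
      ∀ x, rieszPotential α g x = c * Real.exp (-Real.pi * ‖x‖ ^ 2) := by
  have hint := integrable_fracLaplaceGaussian n hα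
  have hc1 : 0 < (1 / Real.pi) ^ ((n - α) / 2) * Real.Gamma ((n - α) / 2) :=
    mul_pos (by positivity) (Real.Gamma_pos_of_pos (by linarith))
  have hc2 : 0 < (1 / Real.pi) ^ (α / 2) * Real.Gamma (α / 2) :=
    mul_pos (by positivity) (Real.Gamma_pos_of_pos (by linarith))
  have hc3 : 0 < rieszConst n α := by
    have h1 : 0 < Real.Gamma ((n - α) / 2) := Real.Gamma_pos_of_pos (by linarith)
    have h2 : 0 < Real.Gamma (α / 2) := Real.Gamma_pos_of_pos (by linarith)
    unfold rieszConst
    positivity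
  set c₁ := (1 / Real.pi) ^ ((n - α) / 2) * Real.Gamma ((n - α) / 2)
  set c₂ := (1 / Real.pi) ^ (α / 2) * Real.Gamma (α / 2) with hc₂
  -- The constant equals (2π)^(-α), but only its positivity matters.
  refine ⟨fun y => (fracLaplaceGaussian n α y).re, rieszConst n α * (c₂ / c₁), by positivity,
    fun p hp => ?_, fun x => ?_⟩
  · refine memLp_of_integrable_of_bound (C := ∫ ξ, ‖fracGaussian n α ξ‖) hint.re (fun y => ?_) hp
    exact (Complex.abs_re_le_norm _).trans (norm_fracLaplaceGaussian_le n α y)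
  · rw [rieszPotential, mul_assoc]
    congr 1
    have hk := integrable_kernel_mul hn hα hαn hint (norm_fracLaplaceGaussian_le n α) x
    have h := congrArg Complex.re (integral_kernel_mul_fracLaplaceGaussian hn hα hαn x)
    rw [Complex.re_ofReal_mul, Complex.ofReal_re] at h
    have hre : (∫ y, ((‖x - y‖ ^ (α - n) : ℝ) : ℂ) * fracLaplaceGaussian n α y).re
        = ∫ y, ‖x - y‖ ^ (α - n) * (fracLaplaceGaussian n α y).re := by
      rw [← RCLike.re_eq_complex_re, ← integral_re hk]
      congr 1 with y
      exact Complex.re_ofReal_mul _ _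
    rw [hre] at h
    have h' : c₁ * ∫ y, ‖x - y‖ ^ (α - n) * (fracLaplaceGaussian n α y).re =
      c₂ * Real.exp (-Real.pi * ‖x‖ ^ 2) := h
    rw [div_mul_eq_mul_div, ← h', mul_div_cancel_left₀ _ hc1.ne']

/-! ### The capacity of balls -/

lemma rieszPotential_comp_affine {n : ℕ} (α : ℝ) (g : Rn n → ℝ) (x₀ x : Rn n) {r : ℝ}
    (hr : 0 < r) :
    rieszPotential α (fun y => g (r⁻¹ • (y - x₀))) x =
      r ^ α * rieszPotential α g (r⁻¹ • (x - x₀)) := by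
  unfold rieszPotential
  have h1 : ∀ y, ‖x - y‖ ^ (α - n) * g (r⁻¹ • (y - x₀)) = r ^ (α - n) *
      (‖r⁻¹ • (x - x₀) - r⁻¹ • (y - x₀)‖ ^ (α - n) * g (r⁻¹ • (y - x₀))) := by
    intro y
    rw [← smul_sub, sub_sub_sub_cancel_right, norm_smul, Real.norm_of_nonneg (by positivity),
      ← mul_assoc, ← Real.mul_rpow hr.le (by positivity), mul_inv_cancel_left₀ hr.ne']
  simp_rw [h1]
  rw [integral_const_mul,
    integral_sub_right_eq_self (fun y => ‖r⁻¹ • (x - x₀) - r⁻¹ • y‖ ^ (α - n) * g (r⁻¹ • y)) x₀,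
    Measure.integral_comp_inv_smul_of_nonneg volume
      (fun y => ‖r⁻¹ • (x - x₀) - y‖ ^ (α - n) * g y) hr.le, finrank_euclideanSpace_fin,
    smul_eq_mul, ← mul_assoc (r ^ (α - n)), ← Real.rpow_natCast, ← Real.rpow_add hr,
    sub_add_cancel]
  ring

lemma eLpNorm_comp_affine {n : ℕ} {p : ℝ} (hp : 0 < p) (g : Rn n → ℝ) (x₀ : Rn n) {r : ℝ}
    (hr : 0 < r) :
    eLpNorm (fun y => g (r⁻¹ • (y - x₀))) (ENNReal.ofReal p) volume =
      ENNReal.ofReal (r ^ (n / p)) * eLpNorm g (ENNReal.ofReal p) volume := by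
  rw [eLpNorm_eq_lintegral_rpow_enorm_toReal (by simpa using hp) ENNReal.ofReal_ne_top,
    eLpNorm_eq_lintegral_rpow_enorm_toReal (by simpa using hp) ENNReal.ofReal_ne_top,
    ENNReal.toReal_ofReal hp.le,
    lintegral_sub_right_eq_self (fun y => ‖g (r⁻¹ • y)‖ₑ ^ p) x₀,
    lintegral_eq_mul_lintegral_smul _ hr]
  simp_rw [inv_smul_smul₀ hr.ne']
  rw [ENNReal.mul_rpow_of_nonneg _ _ (by positivity),
    ENNReal.ofReal_rpow_of_nonneg (by positivity) (by positivity), ← Real.rpow_natCast,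
    ← Real.rpow_mul hr.le, mul_one_div]

/-- The competitor is the Gaussian moved to the ball and multiplied by e^π, so that it is at least 1
there. Its density carries r^(-α) from the homogeneity of the potential and r^(n/p) from the L^p
norm. -/
lemma exists_rieszCap_ball_le {n : ℕ} (hn : 1 ≤ n) {α p : ℝ} (hp : 1 ≤ p) (hα : 0 < α)
    (hαp : α < n / p) :
    ∃ K : ℝ≥0, 0 < K ∧ ∀ (x : Rn n) (r : ℝ≥0), 0 < r →
      rieszCap α p (Metric.ball x r) ≤ ((K * r ^ (n / p - α)) ^ p : ℝ≥0) := by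
  have hp0 : 0 < p := by linarith
  have hαn : α < n := hαp.trans_le (div_le_self (by positivity) hp)
  obtain ⟨g, c, hc, hg, hgG⟩ := exists_rieszPotential_eq_gaussian hn hα hαn
  have hg1 : Integrable g := memLp_one_iff_integrable.1 (by simpa using hg 1 le_rfl)
  set A := Real.exp Real.pi with hA
  refine ⟨(A / c).toNNReal * (eLpNorm g (ENNReal.ofReal p) volume).toNNReal + 1, by positivity,
    fun x₀ r hr => ?_⟩
  have hr' : (0 : ℝ) < r := hr
  set f : SchwartzMap (Rn n) ℝ := A • SchwartzMap.compSubConstCLM ℝ x₀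
    (SchwartzMap.compCLMOfContinuousLinearEquiv ℝ
      (ContinuousLinearEquiv.smulLeft (Units.mk0 ((r : ℝ)⁻¹) (inv_ne_zero hr'.ne')))
      (gaussianSchwartz n)) with hf
  have hfapp : ∀ x, f x = A * Real.exp (-Real.pi * ‖(r : ℝ)⁻¹ • (x - x₀)‖ ^ 2) := fun x => rfl
  set h : Rn n → ℝ := fun y => (A / c * (r : ℝ) ^ (-α)) * g ((r : ℝ)⁻¹ • (y - x₀)) with hh
  have hmeas : AEStronglyMeasurable (fun y => g ((r : ℝ)⁻¹ • (y - x₀))) volume :=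
    ((hg1.comp_smul (inv_ne_zero hr'.ne')).comp_sub_right x₀).1
  have hnorm : eLpNorm h (ENNReal.ofReal p) volume =
      ENNReal.ofReal (A / c) * eLpNorm g (ENNReal.ofReal p) volume *
        ENNReal.ofReal ((r : ℝ) ^ (n / p - α)) := by
    have h1 : h = (A / c * (r : ℝ) ^ (-α)) • fun y => g ((r : ℝ)⁻¹ • (y - x₀)) := rfl
    rw [h1, eLpNorm_const_smul, eLpNorm_comp_affine hp0 g x₀ hr',
      Real.enorm_of_nonneg (by positivity), ENNReal.ofReal_mul (by positivity), sub_eq_neg_add,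
      Real.rpow_add hr', ENNReal.ofReal_mul (by positivity)]
    ring
  have hle : eLpNorm h (ENNReal.ofReal p) volume ≤ (((A / c).toNNReal *
      (eLpNorm g (ENNReal.ofReal p) volume).toNNReal + 1) * r ^ (n / p - α) : ℝ≥0) := by
    rw [hnorm, ENNReal.coe_mul, ENNReal.coe_add, ENNReal.coe_mul,
      ENNReal.coe_toNNReal (hg p hp).2.ne,
      ← ENNReal.ofReal_rpow_of_nonneg r.coe_nonneg (by linarith), ENNReal.ofReal_coe_nnreal,
      ← ENNReal.coe_rpow_of_nonneg _ (by linarith)]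
    gcongr
    exact le_self_add
  have hmem : MemLp h (ENNReal.ofReal p) volume :=
    ⟨hmeas.const_mul _, hle.trans_lt ENNReal.coe_lt_top⟩
  have hpot : ∀ x, f x = rieszPotential α h x := by
    intro x
    have h1 : rieszPotential α h x = (A / c * (r : ℝ) ^ (-α)) *
        rieszPotential α (fun y => g ((r : ℝ)⁻¹ • (y - x₀))) x := by
      simp only [rieszPotential, hh]
      rw [mul_left_comm, ← integral_const_mul (A / c * (r : ℝ) ^ (-α))]
      congr 1
      refine integral_congr_ae (Filter.Eventually.of_forall fun y => ?_)
      simp only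
      ring
    rw [h1, rieszPotential_comp_affine α g x₀ x hr', hgG, hfapp, Real.rpow_neg hr'.le]
    have : (r : ℝ) ^ α ≠ 0 := by positivity
    field_simp
  have hf0 : ∀ x, 0 ≤ f x := fun x => by rw [hfapp]; positivity
  have hf1 : ∀ x ∈ Metric.ball x₀ (r : ℝ), 1 ≤ f x := by
    intro x hx
    rw [hfapp, hA, ← Real.exp_add, Real.one_le_exp_iff]
    have h1 : ‖(r : ℝ)⁻¹ • (x - x₀)‖ ≤ 1 := by
      rw [norm_smul, Real.norm_of_nonneg (by positivity), inv_mul_le_one₀ hr', ← dist_eq_norm]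
      exact (Metric.mem_ball.1 hx).le
    have h2 : ‖(r : ℝ)⁻¹ • (x - x₀)‖ ^ 2 ≤ 1 := pow_le_one₀ (norm_nonneg _) h1
    nlinarith [Real.pi_pos]
  rw [ENNReal.coe_rpow_of_nonneg _ hp0.le]
  refine (iInf_le_of_le f (iInf_le_of_le hf0 (iInf_le _ hf1))).trans ?_
  refine ENNReal.rpow_le_rpow (le_trans ?_ hle) hp0.le
  exact iInf_le_of_le h (iInf_le_of_le hmem (iInf_le _ (Filter.Eventually.of_forall hpot)))

/-! ### The converse inclusion and the equality of the two classes -/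

theorem capClass_subset_carlesonClass {n : ℕ} (hn : 1 ≤ n) {α p : ℝ} (hp : 1 ≤ p) (hα : 0 < α)
    (hαp : α < n / p) {Φ : ℝ≥0 → ℝ≥0}
    (hmono : ∃ Φ' : ℝ≥0 → ℝ≥0, StrictMono Φ' ∧ Comparable Φ Φ')
    (hdoubling : DoublingCondition Φ) :
    CapClass n α p (fun s => Φ (s ^ (1 / (n - α * p)))) ⊆ CarlesonClass n Φ := by
  rintro μ ⟨C, hC, hμ⟩
  have hp0 : 0 < p := by linarith
  have hδ : 0 < n / p - α := by linarith
  obtain ⟨K, hK, hKle⟩ := exists_rieszCap_ball_le hn hp hα hαp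
  obtain ⟨D, hD, hDle⟩ := exists_le_mul_of_doubling hmono hdoubling
    (K := K ^ (1 / (n / p - α))) (by positivity)
  refine ⟨C * D, by positivity, fun x r hr => (hμ _ Metric.isOpen_ball).trans ?_⟩
  have hcap := hKle x r hr
  have htop : rieszCap α p (Metric.ball x r) ≠ ⊤ := (hcap.trans_lt ENNReal.coe_lt_top).ne
  rw [extendTop, if_neg htop, ENNReal.coe_mul, mul_assoc]
  gcongr
  rw [← ENNReal.coe_mul, ENNReal.coe_le_coe]
  refine hDle _ _ ?_
  have h1 : (rieszCap α p (Metric.ball x r)).toNNReal ≤ (K * r ^ (n / p - α)) ^ p := by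
    rwa [← ENNReal.coe_le_coe, ENNReal.coe_toNNReal htop]
  have he : p * (1 / (n - α * p)) = 1 / (n / p - α) := by
    have : n / p - α = (n - α * p) / p := by field_simp
    rw [this]
    field_simp
  have hpos : 0 < n - α * p := by rwa [sub_pos, ← lt_div_iff₀ hp0]
  calc (rieszCap α p (Metric.ball x r)).toNNReal ^ (1 / (n - α * p))
      ≤ ((K * r ^ (n / p - α)) ^ p) ^ (1 / (n - α * p)) :=
        NNReal.rpow_le_rpow h1 (by positivity)
    _ = K ^ (1 / (n / p - α)) * r := by
        rw [← NNReal.rpow_mul, he, NNReal.mul_rpow, ← NNReal.rpow_mul, mul_one_div_cancel hδ.ne',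
          NNReal.rpow_one]

theorem mainTheorem1 (n : ℕ) (α p : ℝ) (hp : 1 ≤ p) (hα : 0 < α) (hαp : α < n / p)
    (Φ : ℝ≥0 → ℝ≥0) (hsurj : Function.Surjective Φ)
    (hmono : ∃ Φ' : ℝ≥0 → ℝ≥0, StrictMono Φ' ∧ Comparable Φ Φ')
    (hdoubling : DoublingCondition Φ) (hint : IntegralCondition n α p Φ) :
    CapClass n α p (fun s => Φ (s ^ (1 / (n - α * p)))) = CarlesonClass n Φ := by
  have hn : 1 ≤ n := by
    rcases Nat.eq_zero_or_pos n with rfl | h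
    · simp only [Nat.cast_zero, zero_div] at hαp
      linarith
    · exact h
  exact (capClass_subset_carlesonClass hn hp hα hαp hmono hdoubling).antisymm
    (carlesonClass_subset_capClass hn hp hα hαp hsurj hmono hdoubling hint)
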